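/- Let $G$ be a finite simple graph. A graph is $k$-vertex-connected if it has more than $k$ nodes and remains connected after deleting any fewer than $k$ nodes. The biconnected components of $G$ are its maximal subgraphs that are 2-vertex-connected or a single link (two nodes and the link joining them). A $2$-vertex cut $\{a,b\}$ of a graph $H$, with the nodes other than $a,b$ partitioned into nonempty sets $A,B$ with no link between them, splits $H$ into the two simple graphs induced on $A\cup\{a,b\}$ and on $B\cup\{a,b\}$, each completed by the link $ab$ if it is missing. A triconnected component decomposition of $G$ is the multiset of graphs obtained by splitting every biconnected component of $G$, and the resulting pieces, at arbitrarily chosen $2$-vertex cuts until no piece has a $2$-vertex cut; its members are the triconnected components. A link that is not in $G$ is called virtual. Two polygons (cycle graphs; triangles included) in a collection that share a virtual link $ab$ contained in no other member of the collection may be merged, i.e. replaced by their union without $ab$; the maximal polygons of a decomposition are the polygons that are present when its triangles have been merged in this way as much as possible. Theorem. $G$ has a triconnected component decomposition, and in every one each component is 3-vertex-connected, a single link, or a triangle. Moreover: (i) The 3-vertex-connected components and the single-link components (as labelled graphs, with multiplicity) are the same in all triconnected component decompositions of $G$. The triangle components need not be: there is a connected graph (on four nodes) with two decompositions that have different triangle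 components. (ii) The total number of triconnected components is the same in all decompositions of $G$. Furthermore, merging always terminates with the same maximal polygons, whatever the decomposition and the order of merging; in each decomposition the collection of all triangle components is the union (with multiplicity) of one complete splitting of each maximal polygon; and every complete splitting of a maximal polygon on $\tau$ nodes consists of exactly $\tau-2$ triangles. -/

import Mathlib

/-- A graph whose nodes are taken from `V`: a subgraph of the complete graph on `V`.  Its links need
not be links of the network under study, so that virtual links are allowed. -/
abbrev Piece (V : Type*) := (⊤ : SimpleGraph V).Subgraph

namespace Piece

variable {V : Type*}

/-- `H` is `k`-vertex-connected: it has more than `k` nodes, and it stays connected whenever fewer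
than `k` nodes are deleted. -/
def IsVertexConnected (k : ℕ) (H : Piece V) : Prop :=
  k < H.verts.ncard ∧ ∀ X : Finset V, X.card < k → (H.deleteVerts (X : Set V)).Connected

/-- `H` is a complete graph on exactly `k` nodes. -/
def IsCompleteOn (k : ℕ) (H : Piece V) : Prop :=
  H.verts.ncard = k ∧ ∀ x ∈ H.verts, ∀ y ∈ H.verts, x ≠ y → H.Adj x y

/-- Two nodes and the link between them. -/
def IsSingleLink (H : Piece V) : Prop := IsCompleteOn 2 H

/-- Three nodes and the three links between them. -/
def IsTriangle (H : Piece V) : Prop := IsCompleteOn 3 H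

/-- A polygon, i.e. a cycle graph: connected, and every node has exactly two neighbours. -/
def IsPolygon (H : Piece V) : Prop :=
  H.Connected ∧ ∀ x ∈ H.verts, (H.neighborSet x).ncard = 2

/-- `B` is a biconnected component of `G`: a maximal subgraph of `G` that is 2-vertex-connected or
a single link. -/
def IsBiconnectedComponent (G : SimpleGraph V) (B : Piece V) : Prop :=
  Maximal (fun H : Piece V =>
    (∀ x y, H.Adj x y → G.Adj x y) ∧ (IsVertexConnected 2 H ∨ IsSingleLink H)) B

/-- The finite set of all biconnected components of a finite graph. -/
noncomputable def biconnectedComponents [Finite V] (G : SimpleGraph V) : Finset (Piece V) :=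
  (Set.toFinite {B : Piece V | IsBiconnectedComponent G B}).toFinset

/-- `{a, b}` is a 2-vertex cut of `H` that separates the nodes in `A` from the nodes in `B`. -/
structure IsCut (H : Piece V) (a b : V) (A B : Set V) : Prop where
  ne : a ≠ b
  left_mem : a ∈ H.verts
  right_mem : b ∈ H.verts
  nonempty_left : A.Nonempty
  nonempty_right : B.Nonempty
  disjoint : Disjoint A B
  union_eq : A ∪ B = H.verts \ {a, b}
  not_adj : ∀ x ∈ A, ∀ y ∈ B, ¬ H.Adj x y

/-- The part of `H` induced by `A ∪ {a, b}`, completed by the link `ab` (a virtual link if `ab` is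
not yet a link of `H`). -/
def side (H : Piece V) {a b : V} (hab : a ≠ b) (A : Set V) : Piece V :=
  H.induce (A ∪ {a, b}) ⊔ (⊤ : SimpleGraph V).subgraphOfAdj (v := a) (w := b) hab

/-- `SplitsInto H S`: `S` is a possible outcome of splitting `H`, and then the resulting pieces, at
arbitrarily chosen 2-vertex cuts until no piece has a 2-vertex cut any more. -/
inductive SplitsInto : Piece V → Multiset (Piece V) → Prop
  | done {H : Piece V} (h : ∀ a b A B, ¬ IsCut H a b A B) : SplitsInto H {H}
  | split {H : Piece V} {a b : V} {A B : Set V} {S T : Multiset (Piece V)}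
      (h : IsCut H a b A B) (hS : SplitsInto (side H h.ne A) S)
      (hT : SplitsInto (side H h.ne B) T) : SplitsInto H (S + T)

/-- `D` is a triconnected component decomposition of `G`: the multiset of all pieces obtained by
splitting every biconnected component of `G` completely. -/
def IsDecomposition [Finite V] (G : SimpleGraph V) (D : Multiset (Piece V)) : Prop :=
  ∃ f : Piece V → Multiset (Piece V),
    (∀ B ∈ biconnectedComponents G, SplitsInto B (f B)) ∧
      D = ∑ B ∈ biconnectedComponents G, f B

/-- The result of merging `P` and `Q` along the link `ab`: their union without that link. -/
def merge (P Q : Piece V) (a b : V) : Piece V :=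
  (P ⊔ Q).deleteEdges {s(a, b)}

/-- One merging step: two polygons `P`, `Q` of the collection `M` that have a virtual link `ab` (a
link that `G` does not have) in common, where no further member of `M` contains `ab`, are replaced
by their merge along `ab`. -/
def MergeStep (G : SimpleGraph V) (M M' : Multiset (Piece V)) : Prop :=
  ∃ (P Q : Piece V) (N : Multiset (Piece V)) (a b : V),
    M = P ::ₘ Q ::ₘ N ∧ IsPolygon P ∧ IsPolygon Q ∧ P.Adj a b ∧ Q.Adj a b ∧ ¬ G.Adj a b ∧
      (∀ T ∈ N, ¬ T.Adj a b) ∧ M' = merge P Q a b ::ₘ N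

/-- `M` arises from `D` by merging triangles, and the polygons so obtained, as much as possible. -/
def IsFullMerge (G : SimpleGraph V) (D M : Multiset (Piece V)) : Prop :=
  Relation.ReflTransGen (MergeStep G) D M ∧ ∀ M', ¬ MergeStep G M M'

open Classical in
/-- The 3-vertex-connected members of a collection. -/
noncomputable def threeConnected (M : Multiset (Piece V)) : Multiset (Piece V) :=
  M.filter (IsVertexConnected 3)

open Classical in
/-- The single-link members of a collection. -/
noncomputable def singleLinks (M : Multiset (Piece V)) : Multiset (Piece V) :=
  M.filter IsSingleLink

open Classical in
/-- The triangles in a collection. -/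
noncomputable def triangles (M : Multiset (Piece V)) : Multiset (Piece V) :=
  M.filter IsTriangle

open Classical in
/-- The polygons in a collection. -/
noncomputable def polygons (M : Multiset (Piece V)) : Multiset (Piece V) :=
  M.filter IsPolygon

end Piece

/-!
# Uniqueness of triconnected component decompositions

A nonseparable graph without a 2-vertex cut is 3-vertex-connected, a single link or a triangle, and
nonseparability passes to the two sides of a cut; this gives the kinds of components. The rest
rests on comparing decompositions through merging, which does not change the 3-vertex-connected
pieces and the single links.

*Any two decompositions have a common merge.* By induction on the number of nodes it suffices to
compare two splittings of a nonseparable graph `H` that begin with two given cuts `{a, b}` and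
`{c, d}`, and the later cuts can be chosen freely. If the cuts are nested, then splitting at both,
in either order, gives the same pieces (`exists_common_splitting_of_nested`). If they have the same
two nodes, then both are nested with a third cut at these nodes. If they cross, then each of them
separates the nodes of the other one (`IsCut.crossing_symm`), so that `H` is a closed chain of four
corners between `a`, `c`, `b`, `d`, and both splittings can be continued to the same splittings of
the corners and two triangles: `abc` and `abd` for the first, `cda` and `cdb` for the second
(`IsCut.splitsInto_side_of_crossing`). The links `ab` and `cd` are virtual and in no other piece,
and merging along them gives the same quadrilateral in both cases.

*Merging is confluent.* Two merging steps can be completed to a diamond (`MergeStep.diamond`),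
provided that two pieces with a common link have no further common nodes, so that polygons merge to
polygons. This follows from a numerical condition, `IsTreelike`: within a biconnected component,
any nonempty subcollection has at least `2 + ∑ (|T| - 2)` nodes. The biconnected components
satisfy it, and both splitting and merging preserve it. Hence having a common merge is an
equivalence relation, and all decompositions have the same complete merge.

*Counting.* The sum of `|T| - 2` over all pieces is invariant under splitting; a triangle
contributes one and a single link nothing, so that the number of components is determined.
The triangles of a decomposition are regrouped by the merging steps: two polygons that meet in
exactly one link are the two sides of a cut of their merge (`SplitsInto.merge`), so complete
splittings of the two polygons make up one of the merge (`exists_regrouping`).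
-/

namespace Piece

variable {V : Type*}

/-! ### Connectivity in terms of separations -/

theorem connected_iff_forall_separation {K : Piece V} :
    K.Connected ↔ K.verts.Nonempty ∧ ∀ X Y : Set V, X.Nonempty → Y.Nonempty → Disjoint X Y →
      X ∪ Y = K.verts → ∃ x ∈ X, ∃ y ∈ Y, K.Adj x y := by
  constructor
  · refine fun h => ⟨h.nonempty, ?_⟩
    rintro X Y ⟨x, hx⟩ ⟨y, hy⟩ hXY hU
    have hxK : x ∈ K.verts := hU ▸ Or.inl hx
    have hyK : y ∈ K.verts := hU ▸ Or.inr hy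
    obtain ⟨p⟩ := h.coe.preconnected ⟨x, hxK⟩ ⟨y, hyK⟩
    obtain ⟨d, -, hd1, hd2⟩ := p.exists_boundary_dart {z | z.1 ∈ X} hx
      (fun h' => Set.disjoint_left.1 hXY h' hy)
    have hd3 : d.snd.1 ∈ X ∪ Y := hU.superset d.snd.2
    exact ⟨d.fst.1, hd1, d.snd.1, hd3.resolve_left hd2, d.adj⟩
  · rintro ⟨⟨x₀, hx₀⟩, h⟩
    have key : ∀ z : K.verts, K.coe.Reachable ⟨x₀, hx₀⟩ z := by
      by_contra! hc
      obtain ⟨z, hz⟩ := hc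
      obtain ⟨x, ⟨hx, hx'⟩, y, ⟨hy, hy'⟩, hxy⟩ := h
        {z | ∃ h : z ∈ K.verts, K.coe.Reachable ⟨x₀, hx₀⟩ ⟨z, h⟩}
        {z | ∃ h : z ∈ K.verts, ¬ K.coe.Reachable ⟨x₀, hx₀⟩ ⟨z, h⟩}
        ⟨x₀, hx₀, SimpleGraph.Reachable.refl _⟩ ⟨z, z.2, hz⟩
        (Set.disjoint_left.2 fun z hz hz' => hz'.2 hz.2)
        (by
          ext z
          by_cases hzK : z ∈ K.verts
          · simp [hzK, em]
          · simp [hzK])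
      have hadj : K.coe.Adj ⟨x, hx⟩ ⟨y, hy⟩ := hxy
      exact hy' (hx'.trans hadj.reachable)
    have : Nonempty K.verts := ⟨⟨x₀, hx₀⟩⟩
    exact ⟨⟨fun u v => (key u).symm.trans (key v)⟩⟩

/-- `H` has at least two nodes and deleting at most one node `v` never separates it. For a finite
`H` this says that `H` is 2-vertex-connected or a single link. The node `v` need not belong to `H`
or lie outside `X ∪ Y`, so that connectedness of `H` itself is the case `v ∈ X ∪ Y`. -/
def IsNonseparable (H : Piece V) : Prop :=
  2 ≤ H.verts.ncard ∧ ∀ (v : V) (X Y : Set V), X.Nonempty → Y.Nonempty → Disjoint X Y →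
    X ∪ Y ⊆ H.verts → H.verts ⊆ insert v (X ∪ Y) → ∃ x ∈ X, ∃ y ∈ Y, H.Adj x y

/-- `H` has no 2-vertex cut. -/
def IsTerminal (H : Piece V) : Prop := ∀ a b A B, ¬ IsCut H a b A B

theorem IsNonseparable.exists_adj_of_card_le_one {H : Piece V} (h : IsNonseparable H)
    {Z : Finset V} (hZ : Z.card ≤ 1) {X Y : Set V} (hX : X.Nonempty) (hY : Y.Nonempty)
    (hXY : Disjoint X Y) (hU : X ∪ Y = H.verts \ Z) : ∃ x ∈ X, ∃ y ∈ Y, H.Adj x y := by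
  obtain ⟨x, hx⟩ := hX
  have : Nonempty V := ⟨x⟩
  obtain ⟨v, hv⟩ := Finset.card_le_one_iff_subset_singleton.1 hZ
  refine h.2 v X Y ⟨x, hx⟩ hY hXY (hU ▸ Set.sdiff_subset) fun z hz => ?_
  by_cases hzZ : z ∈ (Z : Set V)
  · exact Or.inl (by simpa using hv hzZ)
  · exact Or.inr (hU ▸ ⟨hz, hzZ⟩)

theorem isVertexConnected_of_separation [Finite V] {k : ℕ} {H : Piece V} (hk : k < H.verts.ncard)
    (h : ∀ Z : Finset V, Z.card < k → ∀ X Y : Set V, X.Nonempty → Y.Nonempty → Disjoint X Y →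
      X ∪ Y = H.verts \ Z → ∃ x ∈ X, ∃ y ∈ Y, H.Adj x y) : IsVertexConnected k H := by
  refine ⟨hk, fun Z hZ => connected_iff_forall_separation.2 ⟨?_, fun X Y hX hY hXY hU => ?_⟩⟩
  · rw [SimpleGraph.Subgraph.deleteVerts_verts]
    by_contra hne
    rw [Set.not_nonempty_iff_eq_empty, Set.sdiff_eq_empty] at hne
    have := Set.ncard_le_ncard hne
    rw [Set.ncard_coe_finset] at this
    omega
  · obtain ⟨x, hx, y, hy, hxy⟩ := h Z hZ X Y hX hY hXY hU
    have hx' : x ∈ H.verts \ Z := hU.subset (Or.inl hx)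
    have hy' : y ∈ H.verts \ Z := hU.subset (Or.inr hy)
    exact ⟨x, hx, y, hy, SimpleGraph.Subgraph.deleteVerts_adj.2 ⟨hx'.1, hx'.2, hy'.1, hy'.2, hxy⟩⟩

theorem IsNonseparable.adj_of_ncard_eq_two [Finite V] {H : Piece V} (h : IsNonseparable H)
    (h2 : H.verts.ncard = 2) {x y : V} (hx : x ∈ H.verts) (hy : y ∈ H.verts) (hxy : x ≠ y) :
    H.Adj x y := by
  have hV : H.verts = {x, y} := by
    refine (Set.eq_of_subset_of_ncard_le (Set.pair_subset hx hy) ?_).symm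
    rw [h2, Set.ncard_pair hxy]
  obtain ⟨x', rfl, y', rfl, h'⟩ := h.2 x {x} {y} (Set.singleton_nonempty _)
    (Set.singleton_nonempty _) (by simpa using hxy) (by rw [hV]; rfl)
    (by rw [hV]; exact Set.subset_insert _ _)
  exact h'

theorem isNonseparable_iff [Finite V] {H : Piece V} :
    IsNonseparable H ↔ IsVertexConnected 2 H ∨ IsSingleLink H := by
  constructor
  · intro h
    rcases h.1.lt_or_eq with h3 | h2
    · exact Or.inl (isVertexConnected_of_separation h3 fun Z hZ X Y hX hY hXY hU =>
        h.exists_adj_of_card_le_one (by omega) hX hY hXY hU)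
    · exact Or.inr ⟨h2.symm, fun x hx y hy hxy => h.adj_of_ncard_eq_two h2.symm hx hy hxy⟩
  · rintro (⟨h2, h⟩ | ⟨h2, h⟩)
    · refine ⟨h2.le, fun v X Y hX hY hXY hs hs' => ?_⟩
      have key : ∀ Z : Finset V, Z.card < 2 → X ∪ Y = H.verts \ Z →
          ∃ x ∈ X, ∃ y ∈ Y, H.Adj x y := fun Z hZ hU => by
        obtain ⟨x, hx, y, hy, hxy⟩ :=
          (connected_iff_forall_separation.1 (h Z hZ)).2 X Y hX hY hXY hU
        exact ⟨x, hx, y, hy, (SimpleGraph.Subgraph.deleteVerts_adj.1 hxy).2.2.2.2⟩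
      by_cases hv : v ∈ X ∪ Y
      · exact key ∅ (by simp) (by
          rw [Set.insert_eq_of_mem hv] at hs'
          simpa using hs.antisymm hs')
      · refine key {v} (by simp) (Set.Subset.antisymm (fun z hz => ⟨hs hz, ?_⟩) fun z hz => ?_)
        · rintro hzv
          obtain rfl : z = v := by simpa using hzv
          exact hv hz
        · exact (hs' hz.1).resolve_left (by simpa using hz.2)
    · refine ⟨h2.ge, ?_⟩
      rintro v X Y ⟨x, hx⟩ ⟨y, hy⟩ hXY hs -
      exact ⟨x, hx, y, hy, h x (hs (Or.inl hx)) y (hs (Or.inr hy)) (hXY.ne_of_mem hx hy)⟩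

/-- With at least four nodes, deleting two of them can only separate the graph at a 2-vertex cut. -/
theorem IsNonseparable.classification [Finite V] {H : Piece V} (h : IsNonseparable H)
    (ht : IsTerminal H) : IsVertexConnected 3 H ∨ IsSingleLink H ∨ IsTriangle H := by
  classical
  have hcut : ∀ u v : V, u ≠ v → u ∈ H.verts → v ∈ H.verts → ∀ X Y : Set V, X.Nonempty →
      Y.Nonempty → Disjoint X Y → X ∪ Y = H.verts \ {u, v} → ∃ x ∈ X, ∃ y ∈ Y, H.Adj x y := by
    intro u v huv hu hv X Y hX hY hXY hU
    by_contra! hc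
    exact ht u v X Y ⟨huv, hu, hv, hX, hY, hXY, hU, hc⟩
  rcases Nat.lt_or_ge 3 H.verts.ncard with h4 | h3
  · refine Or.inl (isVertexConnected_of_separation h4 fun Z hZ X Y hX hY hXY hU => ?_)
    rcases Nat.lt_or_ge 1 Z.card with h2 | h1
    · obtain ⟨u, v, huv, rfl⟩ := Finset.card_eq_two.1 (show Z.card = 2 by omega)
      by_cases hu : u ∈ H.verts
      · by_cases hv : v ∈ H.verts
        · exact hcut u v huv hu hv X Y hX hY hXY (by simpa using hU)
        · refine h.exists_adj_of_card_le_one (Z := {u}) (by simp) hX hY hXY ?_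
          rw [hU]; ext z; simp; grind
      · refine h.exists_adj_of_card_le_one (Z := {v}) (by simp) hX hY hXY ?_
        rw [hU]; ext z; simp; grind
    · exact h.exists_adj_of_card_le_one h1 hX hY hXY hU
  · rcases h3.lt_or_eq with h2 | h3
    · have h2 : H.verts.ncard = 2 := by have := h.1; omega
      exact Or.inr (Or.inl ⟨h2, fun x hx y hy hxy => h.adj_of_ncard_eq_two h2 hx hy hxy⟩)
    · refine Or.inr (Or.inr ⟨h3, fun x hx y hy hxy => ?_⟩)
      -- the third node serves as the deleted one
      have hpair : 0 < (H.verts \ {x, y}).ncard := by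
        have := Set.ncard_sdiff_add_ncard_of_subset (Set.pair_subset hx hy)
        rw [Set.ncard_pair hxy] at this
        omega
      obtain ⟨z, hz⟩ := (Set.ncard_pos).1 hpair
      have hV : ({x, y, z} : Set V) = H.verts := by
        refine Set.eq_of_subset_of_ncard_le (by grind) ?_
        rw [h3, Set.ncard_eq_three.2 ⟨x, y, z, hxy, by grind, by grind, rfl⟩]
      obtain ⟨x', rfl, y', rfl, h'⟩ := h.2 z {x} {y} (Set.singleton_nonempty _)
        (Set.singleton_nonempty _) (by simpa using hxy) (by grind) (by rw [← hV]; grind)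
      exact h'

/-! ### Sides of a 2-vertex cut -/

@[simp] theorem side_verts (H : Piece V) {a b : V} (hab : a ≠ b) (A : Set V) :
    (side H hab A).verts = A ∪ {a, b} := by
  simp [side]

theorem side_adj {H : Piece V} {a b : V} {hab : a ≠ b} {A : Set V} {x y : V} :
    (side H hab A).Adj x y ↔ (x ∈ A ∪ {a, b} ∧ y ∈ A ∪ {a, b} ∧ H.Adj x y) ∨
      (x = a ∧ y = b ∨ x = b ∧ y = a) := by
  simp only [side, SimpleGraph.Subgraph.sup_adj, SimpleGraph.Subgraph.induce_adj,
    SimpleGraph.subgraphOfAdj_adj, Sym2.eq_iff]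
  grind

theorem side_comm (H : Piece V) {a b : V} (hab : a ≠ b) (hba : b ≠ a) (A : Set V) :
    side H hba A = side H hab A := by
  refine SimpleGraph.Subgraph.ext (by simp [Set.pair_comm]) ?_
  ext x y
  simp only [side_adj]
  grind

namespace IsCut

variable {H : Piece V} {a b : V} {A B : Set V}

theorem symm (h : IsCut H a b A B) : IsCut H a b B A where
  ne := h.ne
  left_mem := h.left_mem
  right_mem := h.right_mem
  nonempty_left := h.nonempty_right
  nonempty_right := h.nonempty_left
  disjoint := h.disjoint.symm
  union_eq := Set.union_comm A B ▸ h.union_eq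
  not_adj x hx y hy hxy := h.not_adj y hy x hx hxy.symm

theorem swap (h : IsCut H a b A B) : IsCut H b a A B where
  ne := h.ne.symm
  left_mem := h.right_mem
  right_mem := h.left_mem
  nonempty_left := h.nonempty_left
  nonempty_right := h.nonempty_right
  disjoint := h.disjoint
  union_eq := Set.pair_comm a b ▸ h.union_eq
  not_adj := h.not_adj

theorem mem_iff (h : IsCut H a b A B) (x : V) :
    x ∈ H.verts ↔ x ∈ A ∨ x ∈ B ∨ x = a ∨ x = b := by
  have := Set.ext_iff.1 h.union_eq x
  have h1 := h.left_mem
  have h2 := h.right_mem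
  grind

theorem left_notMem (h : IsCut H a b A B) : a ∉ A ∧ b ∉ A := by
  have := Set.ext_iff.1 h.union_eq
  have h1 := this a
  have h2 := this b
  grind

theorem right_notMem (h : IsCut H a b A B) : a ∉ B ∧ b ∉ B := h.symm.left_notMem

theorem notMem_right (h : IsCut H a b A B) {x : V} (hx : x ∈ A) : x ∉ B :=
  Set.disjoint_left.1 h.disjoint hx

theorem notMem_left (h : IsCut H a b A B) {x : V} (hx : x ∈ B) : x ∉ A :=
  h.symm.notMem_right hx

theorem side_verts_subset (h : IsCut H a b A B) : (side H h.ne A).verts ⊆ H.verts := by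
  intro x hx
  rw [h.mem_iff]
  simp at hx
  grind

theorem verts_eq (h : IsCut H a b A B) :
    (side H h.ne A).verts ∪ (side H h.ne B).verts = H.verts := by
  ext x
  rw [h.mem_iff]
  simp
  grind

theorem verts_inter (h : IsCut H a b A B) :
    (side H h.ne A).verts ∩ (side H h.ne B).verts = {a, b} := by
  have := @h.notMem_right
  ext x
  simp
  grind

theorem ncard_side_lt [Finite V] (h : IsCut H a b A B) :
    (side H h.ne A).verts.ncard < H.verts.ncard := by
  refine Set.ncard_lt_ncard ⟨h.side_verts_subset, fun hs => ?_⟩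
  obtain ⟨y, hy⟩ := h.nonempty_right
  have := hs ((h.mem_iff y).2 (Or.inr (Or.inl hy)))
  have h1 := h.notMem_left hy
  have h2 := h.right_notMem
  simp at this
  grind

theorem ncard_add_ncard [Finite V] (h : IsCut H a b A B) :
    (side H h.ne A).verts.ncard + (side H h.ne B).verts.ncard = H.verts.ncard + 2 := by
  rw [← Set.ncard_union_add_ncard_inter, h.verts_eq, h.verts_inter, Set.ncard_pair h.ne]

theorem isNonseparable_side [Finite V] (h : IsCut H a b A B) (hH : IsNonseparable H) :
    IsNonseparable (side H h.ne A) := by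
  -- the part of a separation that avoids `a` and `b` stays separated in `H`
  have key : ∀ (v : V) (X Y : Set V), X.Nonempty → Y.Nonempty → Disjoint X Y →
      X ∪ Y ⊆ (side H h.ne A).verts → (side H h.ne A).verts ⊆ insert v (X ∪ Y) → a ∉ Y → b ∉ Y →
      ∃ x ∈ X, ∃ y ∈ Y, (side H h.ne A).Adj x y := by
    intro v X Y hX hY hXY hs hs' ha hb
    rw [side_verts] at hs hs'
    have hYA : Y ⊆ A := fun y hy => by have := hs (Or.inr hy); simp at this; grind
    obtain ⟨x, hx, y, hy, hxy⟩ := hH.2 v (X ∪ B) Y (hX.mono Set.subset_union_left) hY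
      (Set.disjoint_union_left.2 ⟨hXY, (h.disjoint.mono_left hYA).symm⟩)
      (fun z hz => by rw [h.mem_iff]; have := @hs z; simp at this; grind)
      (fun z hz => by rw [h.mem_iff] at hz; have := @hs' z; simp at this ⊢; grind)
    rcases hx with hx | hx
    · exact ⟨x, hx, y, hy, side_adj.2 (Or.inl ⟨hs (Or.inl hx), hs (Or.inr hy), hxy⟩)⟩
    · exact absurd hxy.symm (h.not_adj y (hYA hy) x hx)
  refine ⟨?_, fun v X Y hX hY hXY hs hs' => ?_⟩
  · rw [← Set.ncard_pair h.ne]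
    exact Set.ncard_le_ncard (by rw [side_verts]; exact Set.subset_union_right)
  · by_cases hYab : a ∉ Y ∧ b ∉ Y
    · exact key v X Y hX hY hXY hs hs' hYab.1 hYab.2
    · by_cases hXab : a ∉ X ∧ b ∉ X
      · obtain ⟨x, hx, y, hy, hxy⟩ := key v Y X hY hX hXY.symm (by rwa [Set.union_comm])
          (by rwa [Set.union_comm]) hXab.1 hXab.2
        exact ⟨y, hy, x, hx, hxy.symm⟩
      · have hd : ∀ z ∈ X, z ∉ Y := fun z hz => Set.disjoint_left.1 hXY hz
        have : a ∈ X ∧ b ∈ Y ∨ b ∈ X ∧ a ∈ Y := by grind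
        rcases this with ⟨h1, h2⟩ | ⟨h1, h2⟩
        · exact ⟨a, h1, b, h2, side_adj.2 (by simp)⟩
        · exact ⟨b, h1, a, h2, side_adj.2 (by simp)⟩

/-- In a nonseparable graph both nodes of a cut are attached to each of its parts, as otherwise the
other node alone would separate. -/
theorem exists_adj_left (h : IsCut H a b A B) (hH : IsNonseparable H) :
    ∃ x ∈ A, H.Adj a x := by
  have hm := h.mem_iff
  have hn := h.left_notMem
  have hd := @h.notMem_right
  have hne := h.ne
  have hn' := h.right_notMem
  obtain ⟨x, hx, y, hy, hxy⟩ := hH.2 b A (insert a B) h.nonempty_left (Set.insert_nonempty _ _)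
    (Set.disjoint_left.2 (by grind)) (fun z => by grind) (fun z => by grind)
  rcases hy with rfl | hy
  · exact ⟨x, hx, hxy.symm⟩
  · exact absurd hxy (h.not_adj x hx y hy)

end IsCut

/-! ### Polygons -/

theorem IsPolygon.isCycles {P : Piece V} (h : IsPolygon P) : P.spanningCoe.IsCycles := by
  rintro v ⟨w, hw⟩
  exact h.2 v (P.edge_vert hw)

/-- A link of a polygon is not a bridge. -/
theorem IsPolygon.exists_boundary [Finite V] {P : Piece V} (h : IsPolygon P) {a b : V}
    (hab : P.Adj a b) {X : Set V} (ha : a ∈ X) (hb : b ∉ X) :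
    ∃ x ∈ X, ∃ y ∉ X, P.Adj x y ∧ s(x, y) ≠ s(a, b) := by
  obtain ⟨p⟩ := h.isCycles.reachable_deleteEdges (v := a) (w := b) hab
  obtain ⟨d, -, hd1, hd2⟩ := p.exists_boundary_dart X ha hb
  have := d.adj
  rw [SimpleGraph.deleteEdges_adj] at this
  exact ⟨d.fst, hd1, d.snd, hd2, this.1, this.2⟩

theorem IsPolygon.exists_neighborSet_eq {P : Piece V} (h : IsPolygon P) {x : V} (hx : x ∈ P.verts) :
    ∃ u w, u ≠ w ∧ P.neighborSet x = {u, w} :=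
  Set.ncard_eq_two.1 (h.2 x hx)

theorem IsPolygon.three_le_ncard [Finite V] {P : Piece V} (h : IsPolygon P) :
    3 ≤ P.verts.ncard := by
  obtain ⟨x, hx⟩ := h.1.nonempty
  obtain ⟨u, w, huw, hN⟩ := h.exists_neighborSet_eq hx
  have hu : P.Adj x u := by rw [← SimpleGraph.Subgraph.mem_neighborSet, hN]; simp
  have hw : P.Adj x w := by rw [← SimpleGraph.Subgraph.mem_neighborSet, hN]; simp
  rw [← Set.ncard_eq_three.2 ⟨x, u, w, hu.ne, hw.ne, huw, rfl⟩]
  refine Set.ncard_le_ncard ?_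
  have h1 := P.edge_vert hu.symm
  have h2 := P.edge_vert hw.symm
  grind

theorem IsPolygon.isNonseparable [Finite V] {P : Piece V} (h : IsPolygon P) :
    IsNonseparable P := by
  refine ⟨by have := h.three_le_ncard; omega, fun v X Y hX hY hXY hs hs' => ?_⟩
  have hconn := (connected_iff_forall_separation.1 h.1).2
  have hd : ∀ z ∈ X, z ∉ Y := fun z hz => Set.disjoint_left.1 hXY hz
  by_cases hv : v ∈ P.verts ∧ v ∉ X ∪ Y
  · obtain ⟨hvP, hv⟩ := hv
    by_contra! hc
    -- `v` has a neighbour in each part, so exactly one in each, and one of the links is a bridge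
    obtain ⟨x, hx, y, hy, hxv⟩ := hconn X (insert v Y) hX (Set.insert_nonempty _ _)
      (Set.disjoint_left.2 (by grind)) (by ext z; have := @hs z; have := @hs' z; grind)
    obtain ⟨x', hx', y', hy', hyv⟩ := hconn (insert v X) Y (Set.insert_nonempty _ _) hY
      (Set.disjoint_left.2 (by grind)) (by ext z; have := @hs z; have := @hs' z; grind)
    have hxv : P.Adj x v := by grind
    have hyv : P.Adj v y' := by grind
    obtain ⟨p, hp, q, hq, hpq, hne⟩ := h.exists_boundary hxv hx (by grind)
    have hqP := P.edge_vert hpq.symm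
    obtain rfl : q = v := by have := @hs' q; grind
    obtain ⟨u, w, huw, hN⟩ := h.exists_neighborSet_eq hvP
    have hN' : ∀ z, P.Adj q z ↔ z = u ∨ z = w := fun z => by
      rw [← SimpleGraph.Subgraph.mem_neighborSet, hN]; simp
    have h1 := (hN' x).1 hxv.symm
    have h2 := (hN' y').1 hyv
    have h3 := (hN' p).1 hpq.symm
    have h4 : p ≠ x := by grind
    grind
  · exact hconn X Y hX hY hXY (by ext z; have := @hs z; have := @hs' z; grind)

theorem IsPolygon.ncard_le_three [Finite V] {P : Piece V} (h : IsPolygon P) (ht : IsTerminal P) :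
    P.verts.ncard ≤ 3 := by
  obtain ⟨x, hx⟩ := h.1.nonempty
  obtain ⟨u, w, huw, hN⟩ := h.exists_neighborSet_eq hx
  have hN' : ∀ z, P.Adj x z ↔ z = u ∨ z = w := fun z => by
    rw [← SimpleGraph.Subgraph.mem_neighborSet, hN]; simp
  have hu : P.Adj x u := (hN' u).2 (Or.inl rfl)
  have hw : P.Adj x w := (hN' w).2 (Or.inr rfl)
  by_contra! hlt
  -- the two neighbours of `x` separate it from the other nodes
  refine ht u w {x} (P.verts \ {x, u, w}) ⟨huw, P.edge_vert hu.symm, P.edge_vert hw.symm,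
    Set.singleton_nonempty _, ?_, by simp, ?_, ?_⟩
  · by_contra hne
    rw [Set.not_nonempty_iff_eq_empty, Set.sdiff_eq_empty] at hne
    have := Set.ncard_le_ncard hne
    rw [Set.ncard_eq_three.2 ⟨x, u, w, hu.ne, hw.ne, huw, rfl⟩] at this
    omega
  · have := hu.ne
    have := hw.ne
    ext z
    simp
    grind
  · rintro y rfl z hz hyz
    have := (hN' z).1 hyz
    grind

theorem IsTriangle.isPolygon {T : Piece V} (h : IsTriangle T) : IsPolygon T := by
  obtain ⟨x, y, z, hxy, hxz, hyz, hV⟩ := Set.ncard_eq_three.1 h.1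
  refine ⟨connected_iff_forall_separation.2 ⟨by simp [hV], ?_⟩, fun u hu => ?_⟩
  · rintro X Y ⟨x, hx⟩ ⟨y, hy⟩ hXY hU
    exact ⟨x, hx, y, hy, h.2 x (hU ▸ Or.inl hx) y (hU ▸ Or.inr hy) (hXY.ne_of_mem hx hy)⟩
  · have : T.neighborSet u = T.verts \ {u} := by
      ext w
      exact ⟨fun hw => ⟨T.edge_vert (SimpleGraph.Subgraph.Adj.symm hw), fun h' => hw.ne h'.symm⟩,
        fun hw => h.2 u hu w hw.1 fun h' => hw.2 h'.symm⟩
    rw [this, Set.ncard_sdiff_singleton_of_mem hu, h.1]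

theorem IsTriangle.isTerminal {T : Piece V} (h : IsTriangle T) : IsTerminal T := by
  rintro a b A B hc
  obtain ⟨x, hx⟩ := hc.nonempty_left
  obtain ⟨y, hy⟩ := hc.nonempty_right
  exact hc.not_adj x hx y hy (h.2 x ((hc.mem_iff x).2 (Or.inl hx)) y
    ((hc.mem_iff y).2 (Or.inr (Or.inl hy))) (hc.disjoint.ne_of_mem hx hy))

theorem IsPolygon.isTriangle [Finite V] {P : Piece V} (h : IsPolygon P) (ht : IsTerminal P) :
    IsTriangle P := by
  have h3 := h.three_le_ncard
  have h3' := h.ncard_le_three ht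
  rcases h.isNonseparable.classification ht with h' | h' | h'
  · have := h'.1
    omega
  · have := h'.1
    omega
  · exact h'

theorem IsPolygon.not_isVertexConnected_three [Finite V] {P : Piece V} (h : IsPolygon P) :
    ¬ IsVertexConnected 3 P := by
  classical
  rintro ⟨h4, hc⟩
  have hnt : ¬ IsTerminal P := fun ht => by
    have := h.ncard_le_three ht
    omega
  simp only [IsTerminal, not_forall, not_not] at hnt
  obtain ⟨a, b, A, B, hcut⟩ := hnt
  obtain ⟨x, hx, y, hy, hxy⟩ := (connected_iff_forall_separation.1 (hc {a, b}
    (by rw [Finset.card_pair hcut.ne]; omega))).2 A B hcut.nonempty_left hcut.nonempty_right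
    hcut.disjoint (by simpa using hcut.union_eq)
  exact hcut.not_adj x hx y hy (SimpleGraph.Subgraph.deleteVerts_adj.1 hxy).2.2.2.2

theorem IsPolygon.not_isSingleLink [Finite V] {P : Piece V} (h : IsPolygon P) :
    ¬ IsSingleLink P := fun h' => by
  have := h.three_le_ncard
  have := h'.1
  omega

theorem IsCut.isPolygon_side [Finite V] {P : Piece V} {a b : V} {A B : Set V}
    (h : IsCut P a b A B) (hP : IsPolygon P) : IsPolygon (side P h.ne A) := by
  have hns := hP.isNonseparable
  -- an end of the cut keeps exactly one of its two links and gains the link `ab`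
  have key : ∀ {a b : V} (h : IsCut P a b A B), ((side P h.ne A).neighborSet a).ncard = 2 := by
    intro a b h
    obtain ⟨p, hp, hap⟩ := h.exists_adj_left hns
    obtain ⟨q, hq, haq⟩ := h.symm.exists_adj_left hns
    have hd := @h.notMem_right
    have hn := h.left_notMem
    have hn' := h.right_notMem
    have hne := h.ne
    obtain ⟨u, w, huw, hN⟩ := hP.exists_neighborSet_eq h.left_mem
    have hN' : ∀ z, P.Adj a z ↔ z = u ∨ z = w := fun z => by
      rw [← SimpleGraph.Subgraph.mem_neighborSet, hN]; simp
    have h1 := (hN' p).1 hap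
    have h2 := (hN' q).1 haq
    refine Set.ncard_eq_two.2 ⟨b, p, by grind, ?_⟩
    ext z
    rw [SimpleGraph.Subgraph.mem_neighborSet, side_adj, hN']
    simp
    grind
  refine ⟨?_, fun x hx => ?_⟩
  · have := h.isNonseparable_side hns
    refine connected_iff_forall_separation.2 ⟨⟨a, by simp⟩, fun X Y hX hY hXY hU => ?_⟩
    exact this.2 a X Y hX hY hXY hU.subset (hU.superset.trans (Set.subset_insert _ _))
  · rw [side_verts] at hx
    rcases hx with hx | rfl | rfl
    · rw [← hP.2 x ((h.mem_iff x).2 (Or.inl hx))]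
      congr 1
      ext z
      have hn := h.left_notMem
      have hz : P.Adj x z → z ∈ A ∪ {a, b} := fun hxz => by
        have h1 := (h.mem_iff z).1 (P.edge_vert hxz.symm)
        have h2 := h.not_adj x hx z
        simp
        grind
      rw [SimpleGraph.Subgraph.mem_neighborSet, SimpleGraph.Subgraph.mem_neighborSet, side_adj]
      grind
    · exact key h
    · rw [side_comm P h.ne.symm h.ne]
      exact key h.swap

/-! ### Merging two pieces along a link -/

@[simp] theorem merge_verts (P Q : Piece V) (a b : V) :
    (merge P Q a b).verts = P.verts ∪ Q.verts := by
  simp [merge]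

theorem merge_adj {P Q : Piece V} {a b x y : V} :
    (merge P Q a b).Adj x y ↔ (P.Adj x y ∨ Q.Adj x y) ∧ s(x, y) ≠ s(a, b) := by
  simp [merge]

theorem merge_comm (P Q : Piece V) (a b : V) : merge P Q a b = merge Q P a b := by
  simp [merge, sup_comm]

theorem merge_link_comm (P Q : Piece V) (a b : V) : merge P Q a b = merge P Q b a := by
  simp [merge, Sym2.eq_swap]

theorem merge_merge {P Q T : Piece V} {a b c d : V} (hT : ¬ T.Adj a b) (hP : ¬ P.Adj c d) :
    merge (merge P Q a b) T c d = merge P (merge Q T c d) a b := by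
  refine SimpleGraph.Subgraph.ext (by simp [Set.union_assoc]) ?_
  ext x y
  simp only [merge_adj, ne_eq, Sym2.eq_iff]
  have := T.adj_comm a b
  have := P.adj_comm c d
  grind

theorem merge_isPolygon [Finite V] {P Q : Piece V} {a b : V} (hP : IsPolygon P) (hQ : IsPolygon Q)
    (haP : P.Adj a b) (haQ : Q.Adj a b) (hPQ : P.verts ∩ Q.verts = {a, b}) :
    IsPolygon (merge P Q a b) := by
  have hI : ∀ x, x ∈ P.verts → x ∈ Q.verts → x = a ∨ x = b := fun x h1 h2 => by
    simpa using hPQ.subset ⟨h1, h2⟩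
  have haP' := P.edge_vert haP
  have hbP' := P.edge_vert haP.symm
  have haQ' := Q.edge_vert haQ
  have hbQ' := Q.edge_vert haQ.symm
  have hPv : ∀ {x y}, P.Adj x y → x ∈ P.verts ∧ y ∈ P.verts := fun h =>
    ⟨P.edge_vert h, P.edge_vert h.symm⟩
  have hQv : ∀ {x y}, Q.Adj x y → x ∈ Q.verts ∧ y ∈ Q.verts := fun h =>
    ⟨Q.edge_vert h, Q.edge_vert h.symm⟩
  refine ⟨connected_iff_forall_separation.2 ⟨⟨a, by simp [haP']⟩, ?_⟩, fun x hx => ?_⟩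
  · intro X Y hX hY hXY hU
    by_contra! hc
    simp only [merge_adj, not_and, not_not] at hc
    rw [merge_verts] at hU
    have hm : ∀ z, (z ∈ X ∨ z ∈ Y) ↔ (z ∈ P.verts ∨ z ∈ Q.verts) := fun z => Set.ext_iff.1 hU z
    have hd : ∀ z ∈ X, z ∉ Y := fun z hz => Set.disjoint_left.1 hXY hz
    -- `a` and `b` are joined by the rest of `P`, so that they are on the same side
    have hab : (a ∈ X ↔ b ∈ X) := by
      constructor
      · intro ha
        by_contra hb
        obtain ⟨p, hp, q, hq, hpq, hne⟩ := hP.exists_boundary haP ha hb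
        have := (hm q).2 (Or.inl (hPv hpq).2)
        exact hne (hc p hp q (by grind) (Or.inl hpq))
      · intro hb
        by_contra ha
        obtain ⟨p, hp, q, hq, hpq, hne⟩ := hP.exists_boundary haP.symm hb ha
        have := (hm q).2 (Or.inl (hPv hpq).2)
        exact hne ((hc p hp q (by grind) (Or.inl hpq)).trans Sym2.eq_swap)
    have key : ∀ K : Piece V, K.Connected → a ∈ K.verts → (∀ z ∈ K.verts, z ∈ X ∨ z ∈ Y) →
        (∀ x y, K.Adj x y → P.Adj x y ∨ Q.Adj x y) →
        (K.verts ⊆ X ∨ K.verts ⊆ Y) := by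
      intro K hK ha hKm hKadj
      by_contra! hn
      rw [Set.not_subset, Set.not_subset] at hn
      obtain ⟨⟨y, hyK, hy⟩, x, hxK, hx⟩ := hn
      obtain ⟨p, hp, q, hq, hpq⟩ := (connected_iff_forall_separation.1 hK).2 (K.verts ∩ X)
        (K.verts ∩ Y) ⟨x, hxK, by grind⟩ ⟨y, hyK, by grind⟩
        (hXY.mono Set.inter_subset_right Set.inter_subset_right)
        (by ext z; have := hKm z; grind)
      have := hc p hp.2 q hq.2 (hKadj p q hpq)
      rw [Sym2.eq_iff] at this
      grind
    have hkP := key P hP.1 haP' (fun z hz => (hm z).2 (Or.inl hz)) (fun x y h => Or.inl h)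
    have hkQ := key Q hQ.1 haQ' (fun z hz => (hm z).2 (Or.inr hz)) (fun x y h => Or.inr h)
    obtain ⟨x, hx⟩ := hX
    obtain ⟨y, hy⟩ := hY
    have h1 := (hm x).1 (Or.inl hx)
    have h2 := (hm y).1 (Or.inr hy)
    rcases hkP with h3 | h3 <;> rcases hkQ with h4 | h4
    · grind
    · exact hd a (h3 haP') (h4 haQ')
    · exact hd a (h4 haQ') (h3 haP')
    · grind
  · -- a node outside the link keeps its neighbours
    have inner : ∀ {P Q : Piece V}, IsPolygon P → (∀ x, x ∈ P.verts → x ∈ Q.verts → x = a ∨ x = b) →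
        x ∈ P.verts → x ≠ a → x ≠ b → ((merge P Q a b).neighborSet x).ncard = 2 := by
      intro P Q hP hI hx hxa hxb
      rw [← hP.2 x hx]
      congr 1
      ext z
      rw [SimpleGraph.Subgraph.mem_neighborSet, SimpleGraph.Subgraph.mem_neighborSet, merge_adj,
        ne_eq, Sym2.eq_iff]
      have := hI x hx
      have : Q.Adj x z → x ∈ Q.verts := fun h => Q.edge_vert h
      grind
    -- an end of the link has one further neighbour in each of the two polygons
    have outer : ∀ a b : V, P.Adj a b → Q.Adj a b →
        (∀ x, x ∈ P.verts → x ∈ Q.verts → x = a ∨ x = b) →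
        ((merge P Q a b).neighborSet a).ncard = 2 := by
      intro a b haP haQ hI
      obtain ⟨p, p', hp, hNp⟩ := hP.exists_neighborSet_eq (P.edge_vert haP)
      obtain ⟨q, q', hq, hNq⟩ := hQ.exists_neighborSet_eq (Q.edge_vert haQ)
      have hNp' : ∀ z, P.Adj a z ↔ z = p ∨ z = p' := fun z => by
        rw [← SimpleGraph.Subgraph.mem_neighborSet, hNp]; simp
      have hNq' : ∀ z, Q.Adj a z ↔ z = q ∨ z = q' := fun z => by
        rw [← SimpleGraph.Subgraph.mem_neighborSet, hNq]; simp
      obtain ⟨u, hub, hu⟩ : ∃ u, u ≠ b ∧ ∀ z, P.Adj a z ↔ z = b ∨ z = u := by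
        have := (hNp' b).1 haP
        rcases this with rfl | rfl
        · exact ⟨p', hp.symm, hNp'⟩
        · exact ⟨p, hp, fun z => (hNp' z).trans or_comm⟩
      obtain ⟨w, hwb, hw⟩ : ∃ w, w ≠ b ∧ ∀ z, Q.Adj a z ↔ z = b ∨ z = w := by
        have := (hNq' b).1 haQ
        rcases this with rfl | rfl
        · exact ⟨q', hq.symm, hNq'⟩
        · exact ⟨q, hq, fun z => (hNq' z).trans or_comm⟩
      have huP := (hu u).2 (Or.inr rfl)
      have hwQ := (hw w).2 (Or.inr rfl)
      refine Set.ncard_eq_two.2 ⟨u, w, ?_, ?_⟩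
      · rintro rfl
        have := hI u (hPv huP).2 (hQv hwQ).2
        have := huP.ne
        grind
      · ext z
        rw [SimpleGraph.Subgraph.mem_neighborSet, merge_adj, hu, hw, ne_eq, Sym2.eq_iff]
        have := haP.ne
        simp
        grind
    by_cases hxa : x = a
    · rw [hxa]
      exact outer a b haP haQ hI
    · by_cases hxb : x = b
      · rw [merge_link_comm, hxb]
        exact outer b a haP.symm haQ.symm fun x h1 h2 => (hI x h1 h2).symm
      · rcases hx with hx | hx
        · exact inner hP hI hx hxa hxb
        · rw [merge_comm]
          exact inner hQ (fun x h1 h2 => hI x h2 h1) hx hxa hxb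

/-! ### Complete splittings -/

theorem exists_splitsInto [Finite V] (H : Piece V) : ∃ S, SplitsInto H S := by
  induction hn : H.verts.ncard using Nat.strong_induction_on generalizing H with
  | _ n ih =>
    by_cases ht : IsTerminal H
    · exact ⟨{H}, .done ht⟩
    · simp only [IsTerminal, not_forall, not_not] at ht
      obtain ⟨a, b, A, B, h⟩ := ht
      obtain ⟨S, hS⟩ := ih _ (hn ▸ h.ncard_side_lt) _ rfl
      obtain ⟨T, hT⟩ := ih _ (hn ▸ h.symm.ncard_side_lt) _ rfl
      exact ⟨S + T, .split h hS hT⟩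

theorem SplitsInto.eq_singleton {H : Piece V} {S : Multiset (Piece V)} (h : SplitsInto H S)
    (ht : IsTerminal H) : S = {H} := by
  cases h with
  | done => rfl
  | split h => exact absurd h (ht _ _ _ _)

theorem SplitsInto.isTerminal {H : Piece V} {S : Multiset (Piece V)} (h : SplitsInto H S) :
    ∀ T ∈ S, IsTerminal T := by
  induction h with
  | done h => intro T hT; rw [Multiset.mem_singleton.1 hT]; exact h
  | split h _ _ ihS ihT =>
    intro T hT
    rcases Multiset.mem_add.1 hT with hT | hT
    exacts [ihS T hT, ihT T hT]

theorem SplitsInto.verts_subset {H : Piece V} {S : Multiset (Piece V)} (h : SplitsInto H S) :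
    ∀ T ∈ S, T.verts ⊆ H.verts := by
  induction h with
  | done h => intro T hT; rw [Multiset.mem_singleton.1 hT]
  | split h _ _ ihS ihT =>
    intro T hT
    rcases Multiset.mem_add.1 hT with hT | hT
    exacts [(ihS T hT).trans h.side_verts_subset, (ihT T hT).trans h.symm.side_verts_subset]

theorem SplitsInto.isNonseparable [Finite V] {H : Piece V} {S : Multiset (Piece V)}
    (h : SplitsInto H S) (hH : IsNonseparable H) : ∀ T ∈ S, IsNonseparable T := by
  induction h with
  | done h => intro T hT; rwa [Multiset.mem_singleton.1 hT]
  | split h _ _ ihS ihT =>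
    intro T hT
    rcases Multiset.mem_add.1 hT with hT | hT
    exacts [ihS (h.isNonseparable_side hH) T hT, ihT (h.symm.isNonseparable_side hH) T hT]

theorem SplitsInto.isTriangle_of_isPolygon [Finite V] {H : Piece V} {S : Multiset (Piece V)}
    (h : SplitsInto H S) (hH : IsPolygon H) : ∀ T ∈ S, IsTriangle T := by
  induction h with
  | done h => intro T hT; rw [Multiset.mem_singleton.1 hT]; exact hH.isTriangle h
  | split h _ _ ihS ihT =>
    intro T hT
    rcases Multiset.mem_add.1 hT with hT | hT
    exacts [ihS (h.isPolygon_side hH) T hT, ihT (h.symm.isPolygon_side hH) T hT]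

/-- The number of nodes of a piece in excess of the two nodes of a link. It is additive under
splitting along a cut and under merging two pieces that meet in just one link. -/
noncomputable def excess (T : Piece V) : ℤ := (T.verts.ncard : ℤ) - 2

theorem SplitsInto.sum_excess [Finite V] {H : Piece V} {S : Multiset (Piece V)}
    (h : SplitsInto H S) : (S.map excess).sum = excess H := by
  induction h with
  | done h => simp
  | split h _ _ ihS ihT =>
    rw [Multiset.map_add, Multiset.sum_add, ihS, ihT]
    have := h.ncard_add_ncard
    simp only [excess]
    omega

theorem SplitsInto.card_add_two [Finite V] {H : Piece V} {S : Multiset (Piece V)}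
    (h : SplitsInto H S) (hH : IsPolygon H) : Multiset.card S + 2 = H.verts.ncard := by
  have h1 := h.sum_excess
  have h2 : S.map excess = S.map fun _ => 1 :=
    Multiset.map_congr rfl fun T hT => by
      simp [excess, (h.isTriangle_of_isPolygon hH T hT).1]
  rw [h2] at h1
  simp only [Multiset.map_const', Multiset.sum_replicate, nsmul_eq_mul, mul_one, excess] at h1
  omega

/-- Two pieces that meet in exactly one common link are the sides of a cut of their merge. -/
theorem SplitsInto.merge [Finite V] {P Q : Piece V} {a b : V} {S T : Multiset (Piece V)}
    (hS : SplitsInto P S) (hT : SplitsInto Q T) (hP : 3 ≤ P.verts.ncard) (hQ : 3 ≤ Q.verts.ncard)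
    (haP : P.Adj a b) (haQ : Q.Adj a b) (hPQ : P.verts ∩ Q.verts = {a, b}) :
    SplitsInto (merge P Q a b) (S + T) := by
  have hI := Set.ext_iff.1 hPQ
  have haP' := P.edge_vert haP
  have hbP' := P.edge_vert haP.symm
  have haQ' := Q.edge_vert haQ
  have hbQ' := Q.edge_vert haQ.symm
  have hne : ∀ {K : Piece V}, 3 ≤ K.verts.ncard → (K.verts \ {a, b}).Nonempty := by
    intro K hK
    by_contra hc
    rw [Set.not_nonempty_iff_eq_empty, Set.sdiff_eq_empty] at hc
    have := Set.ncard_le_ncard hc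
    rw [Set.ncard_pair haP.ne] at this
    omega
  have hcut : IsCut (Piece.merge P Q a b) a b (P.verts \ {a, b}) (Q.verts \ {a, b}) := by
    refine ⟨haP.ne, by simp [haP'], by simp [hbP'], hne hP, hne hQ,
      Set.disjoint_left.2 fun x h1 h2 => h1.2 (hPQ.subset ⟨h1.1, h2.1⟩), ?_, ?_⟩
    · ext x
      simp
      grind
    · rintro x ⟨hx, hx'⟩ y ⟨hy, hy'⟩ hxy
      have hxQ : x ∉ Q.verts := fun h => hx' (hPQ.subset ⟨hx, h⟩)
      have hyP : y ∉ P.verts := fun h => hy' (hPQ.subset ⟨h, hy⟩)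
      rcases (merge_adj.1 hxy).1 with h | h
      · exact hyP (P.edge_vert h.symm)
      · exact hxQ (Q.edge_vert h)
  have hside : ∀ {P Q : Piece V} (hne : a ≠ b), P.Adj a b → Q.Adj a b →
      (∀ x, x ∈ P.verts → x ∈ Q.verts → x = a ∨ x = b) →
      side (Piece.merge P Q a b) hne (P.verts \ {a, b}) = P := by
    intro P Q hne haP haQ hI
    have haP' := P.edge_vert haP
    have hbP' := P.edge_vert haP.symm
    have hU : P.verts \ {a, b} ∪ {a, b} = P.verts :=
      Set.sdiff_union_of_subset (Set.pair_subset haP' hbP')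
    refine SimpleGraph.Subgraph.ext (by rw [side_verts, hU]) ?_
    ext x y
    rw [side_adj, hU, merge_adj, ne_eq, Sym2.eq_iff]
    have h1 : P.Adj x y → x ∈ P.verts ∧ y ∈ P.verts := fun h =>
      ⟨P.edge_vert h, P.edge_vert h.symm⟩
    have h2 : Q.Adj x y → x ∈ Q.verts ∧ y ∈ Q.verts ∧ x ≠ y := fun h =>
      ⟨Q.edge_vert h, Q.edge_vert h.symm, h.ne⟩
    have h3 := hI x
    have h4 := hI y
    have h5 := haP.symm
    grind
  refine SplitsInto.split hcut ?_ ?_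
  · rwa [hside _ haP haQ fun x h1 h2 => by simpa using (hI x).1 ⟨h1, h2⟩]
  · simp only [merge_comm P Q]
    rwa [hside _ haQ haP fun x h1 h2 => by simpa using (hI x).1 ⟨h2, h1⟩]

/-! ### Two cuts of a nonseparable graph -/

/-- A cut `{c, d}` with a part inside `A` remains a cut in the side `A` of the cut `{a, b}`. -/
theorem IsCut.isCut_side {H : Piece V} {a b c d : V} {A B C D : Set V} (h : IsCut H a b A B)
    (h' : IsCut H c d C D) (hDA : D ⊆ A) (ha : a ∈ C ∪ {c, d}) (hb : b ∈ C ∪ {c, d})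
    (hc : c ∈ A ∪ {a, b}) (hd : d ∈ A ∪ {a, b}) (hne : ¬ A ∪ {a, b} ⊆ D ∪ {c, d}) :
    IsCut (side H h.ne A) c d D ((A ∪ {a, b}) \ (D ∪ {c, d})) := by
  have hn := h'.right_notMem
  refine ⟨h'.ne, by simpa using hc, by simpa using hd, h'.nonempty_right,
    Set.sdiff_nonempty.2 hne, Set.disjoint_left.2 (by grind), ?_, ?_⟩
  · ext x
    rw [side_verts]
    have := @hDA x
    grind
  · intro x hx y hy hxy
    have hx' := h'.notMem_left hx
    rcases side_adj.1 hxy with h1 | h1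
    · have hyH := (h'.mem_iff y).1 (h.side_verts_subset (by rw [side_verts]; exact hy.1))
      have := h'.not_adj y (by grind) x hx
      exact this h1.2.2.symm
    · have := h'.ne
      grind

/-- A side of a side is a side of the whole graph, unless it contains the added link `ab` as a
further link. -/
theorem side_side {H : Piece V} {a b c d : V} (hab : a ≠ b) (hcd : c ≠ d) {A D : Set V}
    (hD : D ∪ {c, d} ⊆ A ∪ {a, b}) (h : a ∈ D ∪ {c, d} → b ∈ D ∪ {c, d} → s(a, b) = s(c, d)) :
    side (side H hab A) hcd D = side H hcd D := by
  refine SimpleGraph.Subgraph.ext (by simp) ?_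
  ext x y
  have hx := @hD x
  have hy := @hD y
  rw [Sym2.eq_iff] at h
  rw [side_adj, side_adj, side_adj]
  grind

/-- Two nested cuts `{a, b}` and `{c, d}`: splitting at either of them and then at the other one
gives the same pieces. -/
theorem exists_common_splitting_of_nested [Finite V] {H : Piece V} {a b c d : V}
    {A B C D : Set V} (h : IsCut H a b A B) (h' : IsCut H c d C D) (hBC : B ⊆ C) (hDA : D ⊆ A)
    (ha : a ∈ C ∪ {c, d}) (hb : b ∈ C ∪ {c, d}) (hc : c ∈ A ∪ {a, b}) (hd : d ∈ A ∪ {a, b})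
    (hne : ¬ A ∪ {a, b} ⊆ D ∪ {c, d}) (hne' : ¬ C ∪ {c, d} ⊆ B ∪ {a, b}) :
    ∃ S T S' T', SplitsInto (side H h.ne A) S ∧ SplitsInto (side H h.ne B) T ∧
      SplitsInto (side H h'.ne C) S' ∧ SplitsInto (side H h'.ne D) T' ∧ S + T = S' + T' := by
  have hm := h.mem_iff
  have hm' := h'.mem_iff
  have hn := h.left_notMem
  have hn' := h'.left_notMem
  have hd1 := @h.notMem_right
  have hd2 := @h'.notMem_right
  have hU : (A ∪ {a, b}) \ (D ∪ {c, d}) ∪ {c, d} = (C ∪ {c, d}) \ (B ∪ {a, b}) ∪ {a, b} := by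
    ext x
    have := hm x
    have := hm' x
    have := @hBC x
    have := @hDA x
    have := @hd1 x
    have := @hd2 x
    have := h.right_notMem
    have := h'.right_notMem
    grind
  have middle : side (side H h.ne A) h'.ne ((A ∪ {a, b}) \ (D ∪ {c, d})) =
      side (side H h'.ne C) h.ne ((C ∪ {c, d}) \ (B ∪ {a, b})) := by
    refine SimpleGraph.Subgraph.ext (by rw [side_verts, side_verts, hU]) ?_
    ext x y
    have hx := Set.ext_iff.1 hU x
    have hy := Set.ext_iff.1 hU y
    simp only [side_adj]
    grind
  obtain ⟨SD, hSD⟩ := exists_splitsInto (side H h'.ne D)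
  obtain ⟨SB, hSB⟩ := exists_splitsInto (side H h.ne B)
  obtain ⟨SM, hSM⟩ := exists_splitsInto
    (side (side H h.ne A) h'.ne ((A ∪ {a, b}) \ (D ∪ {c, d})))
  have hSD' : SplitsInto (side (side H h.ne A) h'.ne D) SD := by
    rwa [side_side h.ne h'.ne (by grind) (by have := h.ne; have := h'.right_notMem; grind)]
  have hSB' : SplitsInto (side (side H h'.ne C) h.ne B) SB := by
    rwa [side_side h'.ne h.ne (by grind) (by have := h'.ne; have := h.right_notMem; grind)]
  refine ⟨SD + SM, SB, SB + SM, SD, ?_, hSB, ?_, hSD, by abel⟩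
  · exact SplitsInto.split (h.isCut_side h' hDA ha hb hc hd hne) hSD' hSM
  · exact SplitsInto.split (h'.isCut_side h hBC hc hd ha hb hne') hSB' (by rwa [← middle])

/-- If `{a, b}` separates `c` from `d`, then `{c, d}` separates `a` from `b`. -/
theorem IsCut.crossing_symm {H : Piece V} {a b c d : V} {A B C D : Set V}
    (h : IsCut H a b A B) (h' : IsCut H c d C D) (hH : IsNonseparable H) (hc : c ∈ A) (hd : d ∈ B) :
    a ∈ C ∧ b ∈ D ∨ a ∈ D ∧ b ∈ C := by
  have hn := h.left_notMem
  have hn2 := h.right_notMem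
  have hn' := h'.left_notMem
  have hn2' := h'.right_notMem
  have hm := h.mem_iff
  have hm' := h'.mem_iff
  have hAB := @h.notMem_right
  have hCD := @h'.notMem_right
  -- a part of the cut `{c, d}` containing neither `a` nor `b` would be attached to one node only
  have key : ∀ {a b c d : V} {A B C D : Set V}, IsCut H a b A B → IsCut H c d C D →
      c ∈ A → d ∈ B → a ∈ C → b ∈ C → ∀ x ∈ D, x ∈ A → False := by
    intro a b c d A B C D h h' hc hd ha hb x hxD hxA
    have hn := h.left_notMem
    have hn' := h'.left_notMem
    have hn2' := h'.right_notMem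
    have hm := h.mem_iff
    have hm' := h'.mem_iff
    have hAB := @h.notMem_right
    have hCD := @h'.notMem_right
    obtain ⟨y, ⟨hyD, hyA⟩, z, ⟨hzH, hz⟩, hyz⟩ := hH.2 c (D ∩ A) (H.verts \ insert c (D ∩ A))
      ⟨x, hxD, hxA⟩ ⟨a, by grind, by grind⟩ (Set.disjoint_left.2 (by grind)) (by grind) (by grind)
    have h1 := fun hz => h.not_adj y hyA z hz hyz
    have h2 := fun hz => h'.not_adj z hz y hyD hyz.symm
    grind
  have hac : a ≠ c ∧ a ≠ d ∧ b ≠ c ∧ b ≠ d := by grind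
  have ha := (hm' a).1 h.left_mem
  have hb := (hm' b).1 h.right_mem
  have bad : ∀ {C D : Set V}, IsCut H c d C D → a ∈ C → b ∈ C → False := by
    intro C D h' ha hb
    obtain ⟨x, hx⟩ := h'.nonempty_right
    have hxH := (hm x).1 ((h'.mem_iff x).2 (Or.inr (Or.inl hx)))
    rcases hxH with hxA | hxB | rfl | rfl
    · exact key h h' hc hd ha hb x hx hxA
    · exact key h.symm h'.swap hd hc ha hb x hx hxB
    · exact h'.notMem_right ha hx
    · exact h'.notMem_right hb hx
  have b1 := bad h'
  have b2 := bad h'.symm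
  grind

/-- Two different cuts that do not separate each other's nodes are nested: this is one of the two
inclusions, and the other one is the same statement with the cuts exchanged. -/
theorem IsCut.nested_of_not_crossing {H : Piece V} {a b c d : V} {A B C D : Set V}
    (h : IsCut H a b A B) (h' : IsCut H c d C D) (hH : IsNonseparable H)
    (hne : ¬ ((a = c ∨ a = d) ∧ (b = c ∨ b = d))) (ha : a ∈ C ∪ {c, d}) (hb : b ∈ C ∪ {c, d})
    (hc : c ∈ A ∪ {a, b}) (hd : d ∈ A ∪ {a, b}) : B ⊆ C := by
  by_contra hBC
  obtain ⟨x, hxB, hxC⟩ := Set.not_subset.1 hBC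
  have hn := h.right_notMem
  have hn' := h'.right_notMem
  have hm := h.mem_iff
  have hm' := h'.mem_iff
  have hAB := @h.notMem_right
  have hCD := @h'.notMem_right
  have hxD : x ∈ D := by have := hm x; have := hm' x; grind
  -- `B ∩ D` could only be attached to a common node of the two cuts
  obtain ⟨v, w, hw, hvw, hv⟩ : ∃ v w, (w = a ∨ w = b) ∧ (w ≠ v) ∧
      ∀ z, (z = a ∨ z = b) → (z = c ∨ z = d) → z = v := by
    have := h.ne
    by_cases h1 : a = c ∨ a = d
    · exact ⟨a, b, Or.inr rfl, by grind, by grind⟩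
    · exact ⟨b, a, Or.inl rfl, by grind, by grind⟩
  have hwH : w ∈ H.verts := by
    have := h.left_mem
    have := h.right_mem
    grind
  obtain ⟨y, ⟨hyB, hyD⟩, z, ⟨hzH, hz⟩, hyz⟩ := hH.2 v (B ∩ D) (H.verts \ insert v (B ∩ D))
    ⟨x, hxB, hxD⟩ ⟨w, hwH, by grind⟩ (Set.disjoint_left.2 (by grind)) (by grind) (by grind)
  have h1 := fun hz => h.not_adj z hz y hyB hyz.symm
  have h2 := fun hz => h'.not_adj z hz y hyD hyz.symm
  have h3 := (hm z).1 hzH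
  have h4 := (hm' z).1 hzH
  have h5 := hv z
  grind

/-! ### Crossing cuts -/

/-- The complete graph on the set `s` of nodes. -/
def complete (s : Set V) : Piece V := (⊤ : Piece V).induce s

@[simp] theorem complete_verts (s : Set V) : (complete s).verts = s := rfl

theorem complete_adj {s : Set V} {x y : V} : (complete s).Adj x y ↔ x ∈ s ∧ y ∈ s ∧ x ≠ y := by
  simp [complete]

theorem complete_isTriangle {a b c : V} (hab : a ≠ b) (hac : a ≠ c) (hbc : b ≠ c) :
    IsTriangle (complete {a, b, c}) :=
  ⟨Set.ncard_eq_three.2 ⟨a, b, c, hab, hac, hbc, rfl⟩, fun _ hx _ hy hxy =>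
    complete_adj.2 ⟨hx, hy, hxy⟩⟩

/-- `S` is a complete splitting of the part of `H` that is attached along `a` and `c` and has
interior `P`; there is nothing to split if the interior is empty. -/
def IsCornerSplitting (H : Piece V) (a c : V) (P : Set V) (S : Multiset (Piece V)) : Prop :=
  (P = ∅ → S = 0) ∧ (P.Nonempty → ∃ hac : a ≠ c, SplitsInto (side H hac P) S)

theorem exists_isCornerSplitting [Finite V] (H : Piece V) {a c : V} (hac : a ≠ c) (P : Set V) :
    ∃ S, IsCornerSplitting H a c P S := by
  rcases P.eq_empty_or_nonempty with rfl | hP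
  · exact ⟨0, by simp [IsCornerSplitting]⟩
  · obtain ⟨S, hS⟩ := exists_splitsInto (side H hac P)
    exact ⟨S, fun h => absurd h hP.ne_empty, fun _ => ⟨hac, hS⟩⟩

theorem IsCornerSplitting.symm {H : Piece V} {a c : V} {P : Set V} {S : Multiset (Piece V)}
    (h : IsCornerSplitting H a c P S) : IsCornerSplitting H c a P S := by
  refine ⟨h.1, fun hP => ?_⟩
  obtain ⟨hac, hS⟩ := h.2 hP
  exact ⟨hac.symm, by rwa [side_comm]⟩

theorem IsCornerSplitting.verts_subset {H : Piece V} {a c : V} {P : Set V} {S : Multiset (Piece V)}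
    (h : IsCornerSplitting H a c P S) : ∀ T ∈ S, T.verts ⊆ P ∪ {a, c} := by
  intro T hT
  rcases P.eq_empty_or_nonempty with hP | hP
  · rw [h.1 hP] at hT
    simp at hT
  · obtain ⟨hac, hS⟩ := h.2 hP
    simpa using hS.verts_subset T hT

/-- The part of `K` with interior `P` attached along `a` and `c` can be split off, whether it is
a proper part or just the link `ac`. -/
theorem IsCornerSplitting.splitsInto {K : Piece V} {a c : V} {P R : Set V}
    {X S : Multiset (Piece V)} (hX : IsCornerSplitting K a c P X) (hac : a ≠ c) (ha : a ∈ K.verts)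
    (hc : c ∈ K.verts) (hU : P ∪ R = K.verts \ {a, c}) (hPR : Disjoint P R) (hR : R.Nonempty)
    (hadj : ∀ x ∈ P, ∀ y ∈ R, ¬ K.Adj x y) (hP : P = ∅ → K.Adj a c)
    (hS : SplitsInto (side K hac R) S) : SplitsInto K (X + S) := by
  rcases P.eq_empty_or_nonempty with hP' | hP'
  · have hV : R ∪ {a, c} = K.verts := by
      rw [hP', Set.empty_union] at hU
      rw [hU]
      exact Set.sdiff_union_of_subset (Set.pair_subset ha hc)
    have hK : side K hac R = K := by
      refine SimpleGraph.Subgraph.ext (by rw [side_verts, hV]) ?_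
      ext x y
      have h1 := hP hP'
      have h2 := h1.symm
      have h3 : K.Adj x y → x ∈ K.verts ∧ y ∈ K.verts := fun h =>
        ⟨K.edge_vert h, K.edge_vert h.symm⟩
      rw [side_adj, hV]
      grind
    rw [hX.1 hP', zero_add]
    rwa [hK] at hS
  · obtain ⟨hac, hX⟩ := hX.2 hP'
    exact SplitsInto.split ⟨hac, ha, hc, hP', hR, hPR, hU, hadj⟩ hX hS

/-- If the cuts `{a, b}` and `{c, d}` cross, then the side of `{a, b}` that contains `c` consists of
the corner at `a` and `c`, the corner at `b` and `c`, and the triangle `abc`. -/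
theorem IsCut.splitsInto_side_of_crossing [Finite V] {H : Piece V} {a b c d : V} {A B C D : Set V}
    {X Y : Multiset (Piece V)} (h : IsCut H a b A B) (h' : IsCut H c d C D)
    (hH : IsNonseparable H) (hc : c ∈ A) (hd : d ∈ B) (ha : a ∈ C) (hb : b ∈ D)
    (hX : IsCornerSplitting H a c (A ∩ C) X) (hY : IsCornerSplitting H b c (A ∩ D) Y) :
    SplitsInto (side H h.ne A) (X + (Y + {complete {a, b, c}})) := by
  have hn := h.left_notMem
  have hn' := h'.left_notMem
  have hn2' := h'.right_notMem
  have hAB := @h.notMem_right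
  have hCD := @h'.notMem_right
  have hm' := h'.mem_iff
  have hAH : ∀ x ∈ A, x ∈ H.verts := fun x hx => (h.mem_iff x).2 (Or.inl hx)
  have hac : a ≠ c := by grind
  have hbc : b ≠ c := by grind
  have hab := h.ne
  have hns := h.isNonseparable_side hH
  have hCDadj := h'.not_adj
  have hA : ∀ x ∈ A, x ∈ C ∨ x ∈ D ∨ x = c := by
    intro x hx
    have := (hm' x).1 (hAH x hx)
    have := hAB hx
    grind
  -- an empty corner is a link, as otherwise an end of it would hang on one node only
  have hPac : A ∩ C = ∅ → (side H h.ne A).Adj a c := by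
    intro hP
    have hP' : ∀ x ∈ A, x ∉ C := fun x hx hx' => (hP ▸ (⟨hx, hx'⟩ : x ∈ A ∩ C) : x ∈ (∅ : Set V))
    obtain ⟨x, rfl, y, hy, hxy⟩ := hns.2 b {a} A (Set.singleton_nonempty _) ⟨c, hc⟩
      (by simpa using hn.1) (by rw [side_verts]; grind) (by rw [side_verts]; grind)
    have h1 := side_adj.1 hxy
    have h2 := hCDadj x ha y
    grind
  have hPbc : A ∩ D = ∅ → (side H h.ne A).Adj b c := by
    intro hP
    have hP' : ∀ x ∈ A, x ∉ D := fun x hx hx' => (hP ▸ (⟨hx, hx'⟩ : x ∈ A ∩ D) : x ∈ (∅ : Set V))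
    obtain ⟨x, rfl, y, hy, hxy⟩ := hns.2 a {b} A (Set.singleton_nonempty _) ⟨c, hc⟩
      (by simpa using hn.2) (by rw [side_verts]; grind) (by rw [side_verts]; grind)
    have h1 := side_adj.1 hxy
    have h2 := fun hy hyx => hCDadj y hy x hb hyx
    have h3 : H.Adj x y → H.Adj y x := fun h => h.symm
    grind
  have hX' : IsCornerSplitting (side H h.ne A) a c (A ∩ C) X := by
    refine ⟨hX.1, fun hP => ?_⟩
    obtain ⟨hac, hS⟩ := hX.2 hP
    exact ⟨hac, by rwa [side_side h.ne hac (by grind) (by grind)]⟩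
  have hY' : IsCornerSplitting (side (side H h.ne A) hac (insert b (A ∩ D))) b c (A ∩ D) Y := by
    refine ⟨hY.1, fun hP => ?_⟩
    obtain ⟨hbc, hS⟩ := hY.2 hP
    refine ⟨hbc, ?_⟩
    rwa [side_side hac hbc (by grind) (by grind), side_side h.ne hbc (by grind) (by grind)]
  refine hX'.splitsInto (R := insert b (A ∩ D)) hac (by simp) (by simp [hc]) ?_
    (Set.disjoint_left.2 (by grind)) (Set.insert_nonempty _ _) ?_ hPac ?_
  · ext x
    rw [side_verts]
    have := hA x
    grind
  · intro x hx y hy hxy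
    have h1 := side_adj.1 hxy
    have h2 := hCDadj x hx.2 y
    grind
  · refine hY'.splitsInto (R := {a}) hbc (by simp) (by simp) ?_
      (Set.disjoint_left.2 (by grind)) (Set.singleton_nonempty _) ?_ ?_ ?_
    · ext x
      rw [side_verts]
      grind
    · rintro x hx y rfl hxy
      have h1 := side_adj.1 hxy
      have h2 := fun h => hCDadj y ha x hx.2 h
      have h3 : H.Adj x y → H.Adj y x := fun h => h.symm
      simp only [side_adj] at h1
      grind
    · intro hP
      exact side_adj.2 (Or.inl ⟨by simp, by simp, hPbc hP⟩)
    · have : side (side (side H h.ne A) hac (insert b (A ∩ D))) hbc {a} = complete {a, b, c} := by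
        refine SimpleGraph.Subgraph.ext (by rw [side_verts, complete_verts]; grind) ?_
        ext x y
        have h1 : H.Adj x y → x ≠ y := fun h => h.ne
        rw [complete_adj]
        simp only [side_adj]
        constructor
        · simp only [Set.mem_union, Set.mem_insert_iff, Set.mem_singleton_iff]
          grind
        · simp only [Set.mem_union, Set.mem_insert_iff, Set.mem_singleton_iff, Set.mem_inter_iff]
          grind
      rw [this]
      exact .done (complete_isTriangle hab hac hbc).isTerminal

/-- Merging two triangles along a common link gives a quadrilateral, and it is also obtained from
the triangles on the other side of the flip. -/
theorem merge_complete_flip {a b c d : V} (hab : a ≠ b) (hac : a ≠ c) (had : a ≠ d) (hbc : b ≠ c)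
    (hbd : b ≠ d) (hcd : c ≠ d) :
    merge (complete {a, b, c}) (complete {a, b, d}) a b =
      merge (complete {c, d, a}) (complete {c, d, b}) c d := by
  refine SimpleGraph.Subgraph.ext (by ext x; simp; grind) ?_
  ext x y
  simp only [merge_adj, complete_adj, ne_eq, Sym2.eq_iff, Set.mem_insert_iff,
    Set.mem_singleton_iff]
  grind

/-! ### Treelike collections -/

/-- Distinct members of the family `F` of node sets have at most one node in common. -/
def IsLinear (F : Set (Set V)) : Prop :=
  ∀ W ∈ F, ∀ W' ∈ F, ∀ a b, a ≠ b → a ∈ W → b ∈ W → a ∈ W' → b ∈ W' → W = W'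

/-- The nodes of the members of a collection. -/
def nodes (N : Multiset (Piece V)) : Set V := {x | ∃ T ∈ N, x ∈ T.verts}

/-- Every member of `M` lies in a member of the family `F` (the node sets of the biconnected
components, in the application), and the members of every nonempty subcollection inside one `W ∈ F`
together have as many nodes as if they were glued along links to a tree. The inequality is
inherited when a piece is split or two pieces are merged, so that it replaces an explicit
tree structure. -/
def IsTreelike (F : Set (Set V)) (M : Multiset (Piece V)) : Prop :=
  (∀ T ∈ M, ∃ W ∈ F, T.verts ⊆ W) ∧ ∀ N ≤ M, N ≠ 0 → ∀ W ∈ F, (∀ T ∈ N, T.verts ⊆ W) →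
    2 + (N.map excess).sum ≤ (nodes N).ncard

theorem nodes_cons (T : Piece V) (N : Multiset (Piece V)) :
    nodes (T ::ₘ N) = T.verts ∪ nodes N := by
  ext x
  simp [nodes]

theorem le_cons_cases {α : Type*} {m : α} {N N' : Multiset α} (h : N' ≤ m ::ₘ N) :
    N' ≤ N ∨ ∃ N'', N' = m ::ₘ N'' ∧ N'' ≤ N := by
  by_cases hm : m ∈ N'
  · obtain ⟨N'', rfl⟩ := Multiset.exists_cons_of_mem hm
    exact Or.inr ⟨N'', rfl, (Multiset.cons_le_cons_iff m).1 h⟩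
  · exact Or.inl ((Multiset.le_cons_of_notMem hm).1 h)

theorem IsLinear.common {F : Set (Set V)} (hF : IsLinear F) {M : Multiset (Piece V)}
    (hM : ∀ T ∈ M, ∃ W ∈ F, T.verts ⊆ W) {P : Piece V} (hP : P ∈ M) {W : Set V} (hW : W ∈ F)
    {a b : V} (hab : a ≠ b) (ha : a ∈ P.verts) (hb : b ∈ P.verts) (haW : a ∈ W) (hbW : b ∈ W) :
    P.verts ⊆ W := by
  obtain ⟨W', hW', hPW⟩ := hM P hP
  rwa [hF W hW W' hW' a b hab haW hbW (hPW ha) (hPW hb)]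

/-- Applied to a pair of pieces, the inequality of `IsTreelike` says that they have at most two
common nodes. -/
theorem IsTreelike.inter_eq [Finite V] {F : Set (Set V)} (hF : IsLinear F) {P Q : Piece V}
    {N : Multiset (Piece V)} (h : IsTreelike F (P ::ₘ Q ::ₘ N)) {a b : V} (hab : a ≠ b)
    (haP : a ∈ P.verts) (hbP : b ∈ P.verts) (haQ : a ∈ Q.verts) (hbQ : b ∈ Q.verts) :
    P.verts ∩ Q.verts = {a, b} := by
  obtain ⟨W, hW, hPW⟩ := h.1 P (by simp)
  have hQW := hF.common h.1 (P := Q) (by simp) hW hab haQ hbQ (hPW haP) (hPW hbP)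
  have h1 := h.2 (P ::ₘ Q ::ₘ 0)
    (Multiset.cons_le_cons _ (Multiset.cons_le_cons _ (Multiset.zero_le _))) (by simp) W hW
    (by simp [hPW, hQW])
  simp only [nodes_cons, Multiset.map_cons, Multiset.sum_cons, excess] at h1
  simp only [nodes, Multiset.notMem_zero, false_and, exists_false, Set.ofPred_false,
    Set.union_empty, Multiset.map_zero, Multiset.sum_zero] at h1
  have h2 := Set.ncard_union_add_ncard_inter P.verts Q.verts
  refine (Set.eq_of_subset_of_ncard_le
    (Set.pair_subset (Set.mem_inter haP haQ) (Set.mem_inter hbP hbQ)) ?_).symm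
  rw [Set.ncard_pair hab]
  omega

theorem IsTreelike.merge [Finite V] {F : Set (Set V)} (hF : IsLinear F) {P Q m : Piece V}
    {N : Multiset (Piece V)} (h : IsTreelike F (P ::ₘ Q ::ₘ N)) {a b : V} (hab : a ≠ b)
    (haP : a ∈ P.verts) (hbP : b ∈ P.verts) (haQ : a ∈ Q.verts) (hbQ : b ∈ Q.verts)
    (hm : m.verts = P.verts ∪ Q.verts) : IsTreelike F (m ::ₘ N) := by
  have hI := h.inter_eq hF hab haP hbP haQ hbQ
  have hcard := Set.ncard_union_add_ncard_inter P.verts Q.verts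
  rw [hI, Set.ncard_pair hab, ← hm] at hcard
  refine ⟨fun T hT => ?_, fun N' hN' hne W hW hsub => ?_⟩
  · rcases Multiset.mem_cons.1 hT with rfl | hT
    · obtain ⟨W, hW, hPW⟩ := h.1 P (by simp)
      exact ⟨W, hW, hm ▸ Set.union_subset hPW
        (hF.common h.1 (by simp) hW hab haQ hbQ (hPW haP) (hPW hbP))⟩
    · exact h.1 T (by simp [hT])
  · rcases le_cons_cases hN' with hN₁ | ⟨N₁, rfl, hN₁⟩
    · exact h.2 N' (hN₁.trans ((Multiset.le_cons_self _ _).trans (Multiset.le_cons_self _ _)))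
        hne W hW hsub
    · have hmW := hsub m (by simp)
      rw [hm, Set.union_subset_iff] at hmW
      have h1 := h.2 (P ::ₘ Q ::ₘ N₁) (Multiset.cons_le_cons _ (Multiset.cons_le_cons _ hN₁))
        (by simp) W hW (by
          intro T hT
          rcases Multiset.mem_cons.1 hT with rfl | hT
          · exact hmW.1
          · rcases Multiset.mem_cons.1 hT with rfl | hT
            · exact hmW.2
            · exact hsub T (by simp [hT]))
      rw [nodes_cons, nodes_cons, ← Set.union_assoc, ← hm] at h1
      rw [nodes_cons]
      simp only [Multiset.map_cons, Multiset.sum_cons, excess] at h1 ⊢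
      omega

theorem IsTreelike.split [Finite V] {F : Set (Set V)} (hF : IsLinear F) {H P Q : Piece V}
    {N : Multiset (Piece V)} (h : IsTreelike F (H ::ₘ N)) {a b : V} (hab : a ≠ b)
    (hU : P.verts ∪ Q.verts = H.verts) (hI : P.verts ∩ Q.verts = {a, b}) :
    IsTreelike F (P ::ₘ Q ::ₘ N) := by
  have hcard := Set.ncard_union_add_ncard_inter P.verts Q.verts
  rw [hU, hI, Set.ncard_pair hab] at hcard
  obtain ⟨W₀, hW₀, hHW₀⟩ := h.1 H (by simp)
  have hab' : a ∈ P.verts ∩ Q.verts ∧ b ∈ P.verts ∩ Q.verts := by simp [hI]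
  have hH : ∀ {W}, W ∈ F → a ∈ W → b ∈ W → H.verts ⊆ W := fun hW ha hb =>
    hF.common h.1 (by simp) hW hab (hU ▸ Or.inl hab'.1.1) (hU ▸ Or.inl hab'.2.1) ha hb
  -- replacing `H` by one of the two pieces loses the nodes of the other one, except `a` and `b`
  have one : ∀ {P Q : Piece V}, P.verts ∪ Q.verts = H.verts → P.verts ∩ Q.verts = {a, b} →
      P.verts.ncard + Q.verts.ncard = H.verts.ncard + 2 → ∀ N' ≤ N, ∀ W ∈ F,
      (∀ T ∈ P ::ₘ N', T.verts ⊆ W) →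
      2 + ((P ::ₘ N').map excess).sum ≤ (nodes (P ::ₘ N')).ncard := by
    intro P Q hU hI hcard N' hN' W hW hsub
    have hab' : a ∈ P.verts ∩ Q.verts ∧ b ∈ P.verts ∩ Q.verts := by simp [hI]
    have hHW := hH hW (hsub P (by simp) hab'.1.1) (hsub P (by simp) hab'.2.1)
    have h1 := h.2 (H ::ₘ N') (Multiset.cons_le_cons _ hN') (by simp) W hW (by
      intro T hT
      rcases Multiset.mem_cons.1 hT with rfl | hT
      · exact hHW
      · exact hsub T (by simp [hT]))
    have h2 : nodes (H ::ₘ N') ⊆ nodes (P ::ₘ N') ∪ (Q.verts \ {a, b}) := by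
      rw [nodes_cons, nodes_cons, ← hU]
      rintro x ((hx | hx) | hx)
      · exact Or.inl (Or.inl hx)
      · by_cases hx' : x ∈ ({a, b} : Set V)
        · exact Or.inl (Or.inl (hI.superset hx').1)
        · exact Or.inr ⟨hx, hx'⟩
      · exact Or.inl (Or.inr hx)
    have h3 := (Set.ncard_le_ncard h2).trans (Set.ncard_union_le _ _)
    have h4 := Set.ncard_sdiff_add_ncard_of_subset (s := {a, b}) (t := Q.verts)
      (Set.pair_subset hab'.1.2 hab'.2.2)
    rw [Set.ncard_pair hab] at h4
    simp only [Multiset.map_cons, Multiset.sum_cons, excess] at h1 ⊢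
    omega
  refine ⟨fun T hT => ?_, fun N' hN' hne W hW hsub => ?_⟩
  · rcases Multiset.mem_cons.1 hT with rfl | hT
    · exact ⟨W₀, hW₀, (hU ▸ Set.subset_union_left).trans hHW₀⟩
    · rcases Multiset.mem_cons.1 hT with rfl | hT
      · exact ⟨W₀, hW₀, (hU ▸ Set.subset_union_right).trans hHW₀⟩
      · exact h.1 T (by simp [hT])
  · rcases le_cons_cases hN' with hN₁ | ⟨N₁, rfl, hN₁⟩
    · rcases le_cons_cases hN₁ with hN₂ | ⟨N₂, rfl, hN₂⟩
      · exact h.2 N' (hN₂.trans (Multiset.le_cons_self _ _)) hne W hW hsub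
      · exact one (by rwa [Set.union_comm]) (by rwa [Set.inter_comm]) (by omega) N₂ hN₂ W hW hsub
    · rcases le_cons_cases hN₁ with hN₂ | ⟨N₂, rfl, hN₂⟩
      · exact one hU hI (by omega) N₁ hN₂ W hW hsub
      · have hPW := hsub P (by simp)
        have h1 := h.2 (H ::ₘ N₂) (Multiset.cons_le_cons _ hN₂) (by simp) W hW (by
          intro T hT
          rcases Multiset.mem_cons.1 hT with rfl | hT
          · exact hH hW (hPW hab'.1.1) (hPW hab'.2.1)
          · exact hsub T (by simp [hT]))
        rw [nodes_cons, ← hU] at h1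
        rw [nodes_cons, nodes_cons, ← Set.union_assoc]
        simp only [Multiset.map_cons, Multiset.sum_cons, excess] at h1 ⊢
        omega

theorem IsTreelike.side [Finite V] {F : Set (Set V)} (hF : IsLinear F) {H : Piece V}
    {N : Multiset (Piece V)} (hT : IsTreelike F (H ::ₘ N)) {a b : V} {A B : Set V}
    (h : IsCut H a b A B) : IsTreelike F (side H h.ne A ::ₘ side H h.ne B ::ₘ N) :=
  hT.split hF h.ne h.verts_eq h.verts_inter

theorem IsTreelike.splitsInto [Finite V] {F : Set (Set V)} (hF : IsLinear F) {H : Piece V}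
    {N S : Multiset (Piece V)} (hT : IsTreelike F (H ::ₘ N)) (hS : SplitsInto H S) :
    IsTreelike F (S + N) := by
  induction hS generalizing N with
  | done => simpa using hT
  | @split H a b A B S T h _ _ ihS ihT =>
    have h1 := ihS (hT.side hF h)
    rw [Multiset.add_cons] at h1
    have h2 := ihT h1
    rwa [← add_assoc, add_comm T] at h2

/-! ### Confluence of merging -/

theorem MergeStep.isTreelike [Finite V] {F : Set (Set V)} (hF : IsLinear F) {G : SimpleGraph V}
    {M M' : Multiset (Piece V)} (h : MergeStep G M M') (hM : IsTreelike F M) :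
    IsTreelike F M' := by
  obtain ⟨P, Q, N, a, b, rfl, hP, hQ, haP, haQ, -, -, rfl⟩ := h
  exact hM.merge hF haP.ne (P.edge_vert haP) (P.edge_vert haP.symm) (Q.edge_vert haQ)
    (Q.edge_vert haQ.symm) (merge_verts _ _ _ _)

theorem IsTreelike.merge_isPolygon [Finite V] {F : Set (Set V)} (hF : IsLinear F)
    {P Q : Piece V} {N : Multiset (Piece V)} (h : IsTreelike F (P ::ₘ Q ::ₘ N)) {a b : V}
    (hP : IsPolygon P) (hQ : IsPolygon Q) (haP : P.Adj a b) (haQ : Q.Adj a b) :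
    IsPolygon (Piece.merge P Q a b) :=
  Piece.merge_isPolygon hP hQ haP haQ (h.inter_eq hF haP.ne (P.edge_vert haP)
    (P.edge_vert haP.symm) (Q.edge_vert haQ) (Q.edge_vert haQ.symm))

theorem pair_eq_cases {α : Type*} {p p' q' : α} {N : Multiset α}
    (h : p ::ₘ N = p' ::ₘ q' ::ₘ 0) :
    p = p' ∧ N = q' ::ₘ 0 ∨ p = q' ∧ N = p' ::ₘ 0 := by
  have hp : p ∈ p' ::ₘ q' ::ₘ 0 := h ▸ Multiset.mem_cons_self p N
  simp only [Multiset.mem_cons, Multiset.notMem_zero, or_false] at hp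
  rcases hp with rfl | rfl
  · exact Or.inl ⟨rfl, (Multiset.cons_inj_right p).1 h⟩
  · rw [Multiset.cons_swap] at h
    exact Or.inr ⟨rfl, (Multiset.cons_inj_right p).1 h⟩

/-- Merging `P` with `Q` and then with `T` along two links gives the same as merging `Q` with `T`
first. -/
theorem exists_join_of_shared [Finite V] {F : Set (Set V)} (hF : IsLinear F) {G : SimpleGraph V}
    {P Q T : Piece V} {N : Multiset (Piece V)} {a b c d : V}
    (h : IsTreelike F (P ::ₘ Q ::ₘ T ::ₘ N)) (hP : IsPolygon P) (hQ : IsPolygon Q)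
    (hT : IsPolygon T) (haP : P.Adj a b) (haQ : Q.Adj a b) (hcQ : Q.Adj c d) (hcT : T.Adj c d)
    (hab : ¬ G.Adj a b) (hcd : ¬ G.Adj c d) (haT : ¬ T.Adj a b) (hcP : ¬ P.Adj c d)
    (haN : ∀ K ∈ N, ¬ K.Adj a b) (hcN : ∀ K ∈ N, ¬ K.Adj c d) :
    ∃ Z, MergeStep G (merge P Q a b ::ₘ T ::ₘ N) Z ∧ MergeStep G (merge Q T c d ::ₘ P ::ₘ N) Z := by
  have hne : s(c, d) ≠ s(a, b) := by
    rw [ne_eq, Sym2.eq_iff]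
    rintro (⟨rfl, rfl⟩ | ⟨rfl, rfl⟩)
    exacts [hcP haP, hcP haP.symm]
  have h' : IsTreelike F (Q ::ₘ T ::ₘ P ::ₘ N) := by
    have : P ::ₘ Q ::ₘ T ::ₘ N = Q ::ₘ T ::ₘ P ::ₘ N := by
      rw [Multiset.cons_swap P Q, Multiset.cons_swap P T]
    rwa [← this]
  refine ⟨merge (merge P Q a b) T c d ::ₘ N,
    ⟨_, _, N, c, d, rfl, h.merge_isPolygon hF hP hQ haP haQ, hT, merge_adj.2 ⟨Or.inr hcQ, hne⟩,
      hcT, hcd, hcN, rfl⟩,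
    ⟨P, merge Q T c d, N, a, b, Multiset.cons_swap _ _ _, hP,
      h'.merge_isPolygon hF hQ hT hcQ hcT, haP, merge_adj.2 ⟨Or.inl haQ, hne.symm⟩, hab, haN, ?_⟩⟩
  rw [merge_merge haT hcP]

theorem MergeStep.diamond [Finite V] {F : Set (Set V)} (hF : IsLinear F) {G : SimpleGraph V}
    {M M₁ M₂ : Multiset (Piece V)} (hM : IsTreelike F M) (h₁ : MergeStep G M M₁)
    (h₂ : MergeStep G M M₂) : M₁ = M₂ ∨ ∃ Z, MergeStep G M₁ Z ∧ MergeStep G M₂ Z := by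
  classical
  obtain ⟨P, Q, N, a, b, hMe, hP, hQ, haP, haQ, hab, haN, rfl⟩ := h₁
  obtain ⟨P', Q', N', c, d, hMe', hP', hQ', hcP', hcQ', hcd, hcN', rfl⟩ := h₂
  have inPos : ∀ {K : Piece V} {L : Multiset (Piece V)}, K.Adj c d →
      (K ::ₘ L).filter (fun T => T.Adj c d) = K ::ₘ L.filter (fun T => T.Adj c d) :=
    fun h => Multiset.filter_cons_of_pos _ h
  have outPos : ∀ {K : Piece V} {L : Multiset (Piece V)}, ¬ K.Adj c d →
      (K ::ₘ L).filter (fun T => T.Adj c d) = L.filter (fun T => T.Adj c d) :=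
    fun h => Multiset.filter_cons_of_neg _ h
  have inNeg : ∀ {K : Piece V} {L : Multiset (Piece V)}, ¬ K.Adj c d →
      (K ::ₘ L).filter (fun T => ¬ T.Adj c d) = K ::ₘ L.filter (fun T => ¬ T.Adj c d) :=
    fun h => Multiset.filter_cons_of_pos _ h
  have outNeg : ∀ {K : Piece V} {L : Multiset (Piece V)}, K.Adj c d →
      (K ::ₘ L).filter (fun T => ¬ T.Adj c d) = L.filter (fun T => ¬ T.Adj c d) :=
    fun h => Multiset.filter_cons_of_neg _ (not_not.2 h)
  have hf : M.filter (fun T => T.Adj c d) = P' ::ₘ Q' ::ₘ 0 := by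
    rw [hMe', inPos hcP', inPos hcQ',
      Multiset.filter_eq_nil.2 hcN']
  have hf' : M.filter (fun T => ¬ T.Adj c d) = N' := by
    rw [hMe', outNeg hcP',
      outNeg hcQ', Multiset.filter_eq_self.2 hcN']
  have hNe : N = N.filter (fun T => T.Adj c d) + N.filter (fun T => ¬ T.Adj c d) :=
    (Multiset.filter_add_not _ _).symm
  have haN' : ∀ K ∈ N.filter (fun T => ¬ T.Adj c d), ¬ K.Adj a b :=
    fun K hK => haN K (Multiset.mem_of_mem_filter hK)
  have hcN : ∀ K ∈ N.filter (fun T => ¬ T.Adj c d), ¬ K.Adj c d :=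
    fun K hK => (Multiset.mem_filter.1 hK).2
  rw [hMe] at hf hf'
  -- exactly one of the two polygons merged in the first step takes part in the second step
  have shared : ∀ {P Q : Piece V}, M = P ::ₘ Q ::ₘ N → IsPolygon P → IsPolygon Q → P.Adj a b →
      Q.Adj a b → ¬ P.Adj c d → Q.Adj c d →
      ∃ Z, MergeStep G (merge P Q a b ::ₘ N) Z ∧ MergeStep G (merge P' Q' c d ::ₘ N') Z := by
    intro P Q hMe₁ hP hQ haP haQ hcP hcQ
    rw [← hMe, hMe₁, outPos hcP, inPos hcQ] at hf
    rw [← hMe, hMe₁, inNeg hcP,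
      outNeg hcQ] at hf'
    obtain ⟨T, hT, hcT, hNT, hmT⟩ : ∃ T, IsPolygon T ∧ T.Adj c d ∧
        N.filter (fun T => T.Adj c d) = T ::ₘ 0 ∧ merge P' Q' c d = merge Q T c d := by
      rcases pair_eq_cases hf with ⟨rfl, hN⟩ | ⟨rfl, hN⟩
      · exact ⟨Q', hQ', hcQ', hN, rfl⟩
      · exact ⟨P', hP', hcP', hN, merge_comm _ _ _ _⟩
    have hTN : T ∈ N := Multiset.mem_of_mem_filter (hNT ▸ Multiset.mem_cons_self T 0)
    have hNe' : N = T ::ₘ N.filter (fun T => ¬ T.Adj c d) := by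
      conv_lhs => rw [hNe, hNT]
      rw [Multiset.cons_add, zero_add]
    have hM' := hM
    rw [hMe₁, hNe'] at hM'
    obtain ⟨Z, hZ, hZ'⟩ := exists_join_of_shared hF hM' hP hQ hT haP haQ hcQ hcT hab hcd
      (haN T hTN) hcP haN' hcN
    refine ⟨Z, ?_, ?_⟩
    · rwa [← hNe'] at hZ
    · rwa [hmT, ← hf']
  by_cases hcP : P.Adj c d
  · by_cases hcQ : Q.Adj c d
    · left
      have hI := (hMe ▸ hM).inter_eq hF haP.ne (P.edge_vert haP) (P.edge_vert haP.symm)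
        (Q.edge_vert haQ) (Q.edge_vert haQ.symm)
      have h1 : c = a ∨ c = b := by
        simpa using hI.subset ⟨P.edge_vert hcP, Q.edge_vert hcQ⟩
      have h2 : d = a ∨ d = b := by
        simpa using hI.subset ⟨P.edge_vert hcP.symm, Q.edge_vert hcQ.symm⟩
      have hlink : c = a ∧ d = b ∨ c = b ∧ d = a := by
        have := hcP.ne
        grind
      have hcN : ∀ K ∈ N, ¬ K.Adj c d := by
        intro K hK
        rcases hlink with ⟨rfl, rfl⟩ | ⟨rfl, rfl⟩
        · exact haN K hK
        · exact fun h => haN K hK h.symm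
      rw [inPos hcP, inPos hcQ,
        Multiset.filter_eq_nil.2 hcN] at hf
      rw [outNeg hcP,
        outNeg hcQ, Multiset.filter_eq_self.2 hcN] at hf'
      have hm : merge P Q a b = merge P Q c d := by
        rcases hlink with ⟨rfl, rfl⟩ | ⟨rfl, rfl⟩
        · rfl
        · exact merge_link_comm _ _ _ _
      rw [hm, hf']
      rcases pair_eq_cases hf with ⟨rfl, h⟩ | ⟨rfl, h⟩
      · rw [(Multiset.cons_inj_left 0).1 h]
      · rw [(Multiset.cons_inj_left 0).1 h, merge_comm]
    · right
      rw [merge_comm]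
      exact shared (hMe.trans (Multiset.cons_swap _ _ _)) hQ hP haQ haP hcQ hcP
  · by_cases hcQ : Q.Adj c d
    · exact Or.inr (shared hMe hP hQ haP haQ hcP hcQ)
    · right
      rw [outPos hcP, outPos hcQ] at hf
      rw [inNeg hcP, inNeg hcQ] at hf'
      have hN2 : N = P' ::ₘ Q' ::ₘ N.filter (fun T => ¬ T.Adj c d) := by
        conv_lhs => rw [hNe, hf]
        simp
      have hP'N : P' ∈ N := hN2 ▸ by simp
      have hQ'N : Q' ∈ N := hN2 ▸ by simp
      refine ⟨merge P Q a b ::ₘ merge P' Q' c d ::ₘ N.filter (fun T => ¬ T.Adj c d),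
        ⟨P', Q', merge P Q a b ::ₘ N.filter (fun T => ¬ T.Adj c d), c, d, ?_, hP', hQ', hcP', hcQ',
          hcd, ?_, Multiset.cons_swap _ _ _⟩,
        ⟨P, Q, merge P' Q' c d ::ₘ N.filter (fun T => ¬ T.Adj c d), a, b, ?_, hP, hQ, haP, haQ, hab,
          ?_, rfl⟩⟩
      · conv_lhs => rw [hN2]
        rw [Multiset.cons_swap _ P', Multiset.cons_swap _ Q']
      · intro K hK
        rcases Multiset.mem_cons.1 hK with rfl | hK
        · exact fun h => (merge_adj.1 h).1.elim hcP hcQ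
        · exact hcN K hK
      · rw [← hf', Multiset.cons_swap _ P, Multiset.cons_swap _ Q]
      · intro K hK
        rcases Multiset.mem_cons.1 hK with rfl | hK
        · exact fun h => (merge_adj.1 h).1.elim (haN P' hP'N) (haN Q' hQ'N)
        · exact haN' K hK

/-- A merging step of a treelike collection. -/
def TreelikeStep (F : Set (Set V)) (G : SimpleGraph V) (M M' : Multiset (Piece V)) : Prop :=
  IsTreelike F M ∧ MergeStep G M M'

/-- Two collections have a common outcome of merging. -/
def Joinable (F : Set (Set V)) (G : SimpleGraph V) :
    Multiset (Piece V) → Multiset (Piece V) → Prop :=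
  Relation.Join (Relation.ReflTransGen (TreelikeStep F G))

theorem joinable_equivalence [Finite V] {F : Set (Set V)} (hF : IsLinear F) (G : SimpleGraph V) :
    Equivalence (Joinable F G) := by
  refine Relation.equivalence_join_reflTransGen fun M M₁ M₂ h₁ h₂ => ?_
  rcases MergeStep.diamond hF h₁.1 h₁.2 h₂.2 with rfl | ⟨Z, hZ₁, hZ₂⟩
  · exact ⟨M₁, .refl, .refl⟩
  · exact ⟨Z, .single ⟨h₁.2.isTreelike hF h₁.1, hZ₁⟩,
      .single ⟨h₂.2.isTreelike hF h₂.1, hZ₂⟩⟩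

theorem reflTransGen_treelikeStep [Finite V] {F : Set (Set V)} (hF : IsLinear F)
    {G : SimpleGraph V} {M M' : Multiset (Piece V)} (hM : IsTreelike F M)
    (h : Relation.ReflTransGen (MergeStep G) M M') :
    Relation.ReflTransGen (TreelikeStep F G) M M' ∧ IsTreelike F M' := by
  induction h with
  | refl => exact ⟨.refl, hM⟩
  | tail _ h ih => exact ⟨ih.1.tail ⟨ih.2, h⟩, h.isTreelike hF ih.2⟩

/-- Collections with a common outcome of merging have the same complete merge. -/
theorem Joinable.fullMerge_unique [Finite V] {F : Set (Set V)} (hF : IsLinear F)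
    {G : SimpleGraph V} {D D' M M' : Multiset (Piece V)} (hD : IsTreelike F D)
    (hD' : IsTreelike F D') (h : Joinable F G D D') (hM : IsFullMerge G D M)
    (hM' : IsFullMerge G D' M') : M = M' := by
  have hJ := joinable_equivalence hF G
  have h1 : Joinable F G D M := ⟨M, (reflTransGen_treelikeStep hF hD hM.1).1, .refl⟩
  have h2 : Joinable F G D' M' := ⟨M', (reflTransGen_treelikeStep hF hD' hM'.1).1, .refl⟩
  obtain ⟨Z, hZ, hZ'⟩ := hJ.trans (hJ.trans (hJ.symm h1) h) h2
  have e1 : M = Z := by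
    rcases hZ.cases_head with h | ⟨_, h, -⟩
    · exact h
    · exact absurd h.2 (hM.2 _)
  have e2 : M' = Z := by
    rcases hZ'.cases_head with h | ⟨_, h, -⟩
    · exact h
    · exact absurd h.2 (hM'.2 _)
  rw [e1, e2]

theorem exists_isFullMerge (G : SimpleGraph V) (D : Multiset (Piece V)) :
    ∃ M, IsFullMerge G D M := by
  induction hn : Multiset.card D using Nat.strong_induction_on generalizing D with
  | _ n ih =>
    by_cases h : ∃ D', MergeStep G D D'
    · obtain ⟨D', hD'⟩ := h
      have hc : Multiset.card D' < n := by
        obtain ⟨P, Q, N, a, b, rfl, -, -, -, -, -, -, rfl⟩ := hD'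
        simp at hn ⊢
        omega
      obtain ⟨M, hM, hM'⟩ := ih _ hc D' rfl
      exact ⟨M, .head hD' hM, hM'⟩
    · exact ⟨D, .refl, not_exists.1 h⟩

/-! ### Any two splittings have a common merge -/

/-- Inside the node set of `H`, neither `G` nor the members of `N` have links that `H` lacks. -/
def IsLocal (G : SimpleGraph V) (H : Piece V) (N : Multiset (Piece V)) : Prop :=
  (∀ x ∈ H.verts, ∀ y ∈ H.verts, G.Adj x y → H.Adj x y) ∧
    ∀ T ∈ N, ∀ x ∈ H.verts, ∀ y ∈ H.verts, T.Adj x y → H.Adj x y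

/-- In every context `N` that fits, any two complete splittings of `H` have a common outcome of
merging. -/
def SplittingsJoinable (F : Set (Set V)) (G : SimpleGraph V) (H : Piece V) : Prop :=
  ∀ N, IsLocal G H N → IsTreelike F (H ::ₘ N) → ∀ S S', SplitsInto H S → SplitsInto H S' →
    Joinable F G (S + N) (S' + N)

/-- In the context `N`, the splittings of `H` that begin with the cut `{a, b}` and those that
begin with the cut `{c, d}` have a common outcome of merging. -/
def CutsJoinable (F : Set (Set V)) (G : SimpleGraph V) (H : Piece V) (N : Multiset (Piece V))
    {a b c d : V} (hab : a ≠ b) (A B : Set V) (hcd : c ≠ d) (C D : Set V) : Prop :=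
  ∀ S T S' T', SplitsInto (side H hab A) S → SplitsInto (side H hab B) T →
    SplitsInto (side H hcd C) S' → SplitsInto (side H hcd D) T' →
      Joinable F G (S + T + N) (S' + T' + N)

theorem IsLocal.side {G : SimpleGraph V} {H : Piece V} {N S : Multiset (Piece V)} {a b : V}
    {A B : Set V} (hN : IsLocal G H N) (h : IsCut H a b A B)
    (hS : SplitsInto (side H h.ne B) S) : IsLocal G (side H h.ne A) (S + N) := by
  have hsub := h.side_verts_subset
  have lift : ∀ x ∈ (Piece.side H h.ne A).verts, ∀ y ∈ (Piece.side H h.ne A).verts, H.Adj x y →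
      (Piece.side H h.ne A).Adj x y := fun x hx y hy hxy => by
    rw [side_verts] at hx hy
    exact side_adj.2 (Or.inl ⟨hx, hy, hxy⟩)
  refine ⟨fun x hx y hy hxy => lift x hx y hy (hN.1 x (hsub hx) y (hsub hy) hxy),
    fun T hT x hx y hy hxy => ?_⟩
  rcases Multiset.mem_add.1 hT with hT | hT
  · have hTB := hS.verts_subset T hT
    have h1 := h.verts_inter.subset ⟨hx, hTB (T.edge_vert hxy)⟩
    have h2 := h.verts_inter.subset ⟨hy, hTB (T.edge_vert hxy.symm)⟩
    have h3 := hxy.ne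
    refine side_adj.2 (Or.inr ?_)
    simp only [Set.mem_insert_iff, Set.mem_singleton_iff] at h1 h2
    grind
  · exact lift x hx y hy (hN.2 T hT x (hsub hx) y (hsub hy) hxy)

theorem IsCornerSplitting.not_adj {H : Piece V} {u v x y : V} {P : Set V}
    {S : Multiset (Piece V)} (hS : IsCornerSplitting H u v P S)
    (h : x ∉ P ∪ {u, v} ∨ y ∉ P ∪ {u, v}) : ∀ T ∈ S, ¬ T.Adj x y := by
  intro T hT hxy
  have hsub := hS.verts_subset T hT
  rcases h with h | h
  · exact h (hsub (T.edge_vert hxy))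
  · exact h (hsub (T.edge_vert hxy.symm))

theorem IsTreelike.side_splitsInto [Finite V] {F : Set (Set V)} (hF : IsLinear F) {H : Piece V}
    {N S : Multiset (Piece V)} {a b : V} {A B : Set V} (hT : IsTreelike F (H ::ₘ N))
    (h : IsCut H a b A B) (hS : SplitsInto (Piece.side H h.ne B) S) :
    IsTreelike F (Piece.side H h.ne A ::ₘ (S + N)) := by
  have h1 := hT.side hF h
  rw [Multiset.cons_swap] at h1
  have h2 := h1.splitsInto hF hS
  rwa [Multiset.add_cons] at h2

/-- Splittings that begin with the same cut are compared by changing them on one side of the cut at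
a time, with the other side as part of the context. -/
theorem IsCut.cutsJoinable_self [Finite V] {F : Set (Set V)} (hF : IsLinear F) {G : SimpleGraph V}
    {H : Piece V} {N : Multiset (Piece V)} {a b : V} {A B : Set V} (h : IsCut H a b A B)
    (hA : SplittingsJoinable F G (side H h.ne A)) (hB : SplittingsJoinable F G (side H h.ne B))
    (hN : IsLocal G H N) (hT : IsTreelike F (H ::ₘ N)) :
    CutsJoinable F G H N h.ne A B h.ne A B := by
  intro S T S' T' hS hTB hS' hTB'
  have h1 := hA (T + N) (hN.side h hTB) (hT.side_splitsInto hF h hTB) S S' hS hS'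
  have h2 := hB (S' + N) (hN.side h.symm hS') (hT.side_splitsInto hF h.symm hS') T T' hTB hTB'
  rw [← add_assoc, ← add_assoc] at h1
  rw [← add_assoc, ← add_assoc, add_comm T, add_comm T'] at h2
  exact (joinable_equivalence hF G).trans h1 h2

section

variable {F : Set (Set V)} {G : SimpleGraph V} {H : Piece V} {N : Multiset (Piece V)}
  {a b c d : V} {A B C D : Set V}

theorem CutsJoinable.trans [Finite V] (hF : IsLinear F) {u v : V} {X Y : Set V} {hab : a ≠ b}
    {hcd : c ≠ d} {huv : u ≠ v} (h : CutsJoinable F G H N hab A B hcd C D)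
    (h' : CutsJoinable F G H N hcd C D huv X Y) : CutsJoinable F G H N hab A B huv X Y := by
  intro S T S' T' hS hT hS' hT'
  obtain ⟨U, hU⟩ := exists_splitsInto (side H hcd C)
  obtain ⟨W, hW⟩ := exists_splitsInto (side H hcd D)
  exact (joinable_equivalence hF G).trans (h S T U W hS hT hU hW) (h' U W S' T' hU hW hS' hT')

theorem CutsJoinable.symm [Finite V] (hF : IsLinear F) {hab : a ≠ b} {hcd : c ≠ d}
    (h : CutsJoinable F G H N hab A B hcd C D) : CutsJoinable F G H N hcd C D hab A B :=
  fun S T S' T' hS hT hS' hT' =>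
    (joinable_equivalence hF G).symm (h S' T' S T hS' hT' hS hT)

theorem CutsJoinable.flip_left {hab : a ≠ b} {hcd : c ≠ d}
    (h : CutsJoinable F G H N hab B A hcd C D) : CutsJoinable F G H N hab A B hcd C D :=
  fun S T S' T' hS hT hS' hT' => add_comm T S ▸ h T S S' T' hT hS hS' hT'

theorem CutsJoinable.flip_right {hab : a ≠ b} {hcd : c ≠ d}
    (h : CutsJoinable F G H N hab A B hcd D C) : CutsJoinable F G H N hab A B hcd C D :=
  fun S T S' T' hS hT hS' hT' => add_comm T' S' ▸ h S T T' S' hS hT hT' hS'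

theorem CutsJoinable.swap_right {hab : a ≠ b} {hcd : c ≠ d}
    (h : CutsJoinable F G H N hab A B hcd.symm C D) : CutsJoinable F G H N hab A B hcd C D := by
  intro S T S' T' hS hT hS' hT'
  refine h S T S' T' hS hT ?_ ?_
  · rwa [side_comm]
  · rwa [side_comm]

theorem CutsJoinable.of_common [Finite V] (hF : IsLinear F) {hab : a ≠ b} {hcd : c ≠ d}
    (h : CutsJoinable F G H N hab A B hab A B) (h' : CutsJoinable F G H N hcd C D hcd C D)
    {S T S' T' : Multiset (Piece V)} (hS : SplitsInto (side H hab A) S)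
    (hT : SplitsInto (side H hab B) T) (hS' : SplitsInto (side H hcd C) S')
    (hT' : SplitsInto (side H hcd D) T') (hJ : Joinable F G (S + T + N) (S' + T' + N)) :
    CutsJoinable F G H N hab A B hcd C D := by
  intro X Y X' Y' hX hY hX' hY'
  have hJE := joinable_equivalence hF G
  exact hJE.trans (h X Y S T hX hY hS hT) (hJE.trans hJ (h' S' T' X' Y' hS' hT' hX' hY'))

/-- Splittings that begin with cuts at the same two nodes. -/
theorem IsCut.cutsJoinable_of_same_nodes [Finite V] (hF : IsLinear F)
    (hself : ∀ {A B : Set V} (h : IsCut H a b A B), CutsJoinable F G H N h.ne A B h.ne A B)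
    (h : IsCut H a b A B) (h' : IsCut H a b C D) :
    CutsJoinable F G H N h.ne A B h.ne C D := by
  have key : ∀ {A B C D : Set V} (h : IsCut H a b A B) (h' : IsCut H a b C D), A ⊆ C →
      CutsJoinable F G H N h.ne A B h.ne C D := by
    intro A B C D h h' hAC
    have hm := h.mem_iff
    have hm' := h'.mem_iff
    have hn := h.left_notMem
    have hn' := h'.left_notMem
    have hn2 := h.right_notMem
    have hn2' := h'.right_notMem
    have hAB := @h.notMem_right
    have hCD := @h'.notMem_right
    have hDB : D ⊆ B := fun x hx => by
      have := hm x
      have := hm' x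
      have := @hAC x
      grind
    by_cases hCA : C ⊆ A
    · obtain rfl : A = C := hAC.antisymm hCA
      obtain rfl : B = D := by
        refine Set.Subset.antisymm (fun x hx => ?_) hDB
        have := hm x
        have := hm' x
        grind
      exact hself h
    · obtain ⟨x, hxC, hxA⟩ := Set.not_subset.1 hCA
      have hxB : x ∈ B := by
        have := hm x
        have := hm' x
        grind
      obtain ⟨S, T, S', T', hS, hT, hS', hT', he⟩ := exists_common_splitting_of_nested h.symm h'
        hAC hDB (by simp) (by simp) (by simp) (by simp)
        (fun hs => by have := @hs x (Or.inl hxB); grind)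
        (fun hs => by have := @hs x (Or.inl hxC); grind)
      refine (CutsJoinable.of_common hF (hself h.symm) (hself h') hS hT hS' hT' ?_).flip_left
      rw [he]
      exact (joinable_equivalence hF G).refl _
  by_cases hAC : (A ∩ C).Nonempty
  · -- the common part of the two sides is a side of a cut, too
    have h'' : IsCut H a b (A ∩ C) (B ∪ D) := by
      have hm := h.mem_iff
      have hm' := h'.mem_iff
      have hn := h.left_notMem
      have hn' := h'.left_notMem
      have hn2 := h.right_notMem
      have hn2' := h'.right_notMem
      have hAB := @h.notMem_right
      have hCD := @h'.notMem_right
      refine ⟨h.ne, h.left_mem, h.right_mem, hAC, h.nonempty_right.mono Set.subset_union_left,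
        Set.disjoint_left.2 (by grind), ?_, ?_⟩
      · ext x
        have := hm x
        have := hm' x
        have := @hAB x
        have := @hCD x
        simp only [Set.mem_union, Set.mem_inter_iff, Set.mem_sdiff, Set.mem_insert_iff,
          Set.mem_singleton_iff]
        grind
      · rintro x ⟨hxA, hxC⟩ y (hy | hy)
        · exact h.not_adj x hxA y hy
        · exact h'.not_adj x hxC y hy
    exact ((key h'' h Set.inter_subset_left).symm hF).trans hF (key h'' h' Set.inter_subset_right)
  · have hAD : A ⊆ D := fun x hx => by
      have h1 := (h'.mem_iff x).1 ((h.mem_iff x).2 (Or.inl hx))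
      have h2 : x ∉ C := fun hC => hAC ⟨x, hx, hC⟩
      have h3 := h.left_notMem
      grind
    exact (key h h'.symm hAD).flip_right

/-- Splittings that begin with crossing cuts: cutting along both leaves the same four corners and
two triangles, which come from cutting a quadrilateral along either of its diagonals. -/
theorem IsCut.cutsJoinable_of_crossing [Finite V] (hF : IsLinear F) (hH : IsNonseparable H)
    (hN : IsLocal G H N) (hT : IsTreelike F (H ::ₘ N)) (h : IsCut H a b A B) (h' : IsCut H c d C D)
    (hself : CutsJoinable F G H N h.ne A B h.ne A B)
    (hself' : CutsJoinable F G H N h'.ne C D h'.ne C D)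
    (ha : a ∈ C) (hb : b ∈ D) (hc : c ∈ A) (hd : d ∈ B) :
    CutsJoinable F G H N h.ne A B h'.ne C D := by
  have hn := h.left_notMem
  have hn2 := h.right_notMem
  have hn' := h'.left_notMem
  have hn2' := h'.right_notMem
  have hAB := @h.notMem_right
  have hCD := @h'.notMem_right
  have hab := h.ne
  have hcd := h'.ne
  have hac : a ≠ c := by grind
  have had : a ≠ d := by grind
  have hbc : b ≠ c := by grind
  have hbd : b ≠ d := by grind
  obtain ⟨S₁, hS₁⟩ := exists_isCornerSplitting H hac (A ∩ C)
  obtain ⟨S₂, hS₂⟩ := exists_isCornerSplitting H hbc (A ∩ D)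
  obtain ⟨S₃, hS₃⟩ := exists_isCornerSplitting H had (B ∩ C)
  obtain ⟨S₄, hS₄⟩ := exists_isCornerSplitting H hbd (B ∩ D)
  have sA := h.splitsInto_side_of_crossing h' hH hc hd ha hb hS₁ hS₂
  have sB := h.symm.splitsInto_side_of_crossing h'.swap hH hd hc ha hb hS₃ hS₄
  have sC := h'.splitsInto_side_of_crossing h hH ha hb hc hd
    (Set.inter_comm A C ▸ hS₁.symm) (Set.inter_comm B C ▸ hS₃.symm)
  have sD := h'.symm.splitsInto_side_of_crossing h.swap hH hb ha hc hd
    (Set.inter_comm A D ▸ hS₂.symm) (Set.inter_comm B D ▸ hS₄.symm)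
  refine CutsJoinable.of_common hF hself hself' sA sB sC sD ?_
  have tS := hT.splitsInto hF (SplitsInto.split h sA sB)
  have tS' := hT.splitsInto hF (SplitsInto.split h' sC sD)
  have e : S₁ + (S₂ + {complete {a, b, c}}) + (S₃ + (S₄ + {complete {a, b, d}})) + N =
      complete {a, b, c} ::ₘ complete {a, b, d} ::ₘ (S₁ + S₂ + S₃ + S₄ + N) := by
    simp only [← Multiset.singleton_add]
    abel
  have e' : S₁ + (S₃ + {complete {c, d, a}}) + (S₂ + (S₄ + {complete {c, d, b}})) + N =
      complete {c, d, a} ::ₘ complete {c, d, b} ::ₘ (S₁ + S₂ + S₃ + S₄ + N) := by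
    simp only [← Multiset.singleton_add]
    abel
  rw [e] at tS ⊢
  rw [e'] at tS' ⊢
  have rest : ∀ x y : V, (∀ T ∈ N, ¬ T.Adj x y) → (x ∉ A ∩ C ∪ {a, c} ∨ y ∉ A ∩ C ∪ {a, c}) →
      (x ∉ A ∩ D ∪ {b, c} ∨ y ∉ A ∩ D ∪ {b, c}) → (x ∉ B ∩ C ∪ {a, d} ∨ y ∉ B ∩ C ∪ {a, d}) →
      (x ∉ B ∩ D ∪ {b, d} ∨ y ∉ B ∩ D ∪ {b, d}) → ∀ T ∈ S₁ + S₂ + S₃ + S₄ + N, ¬ T.Adj x y := by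
    intro x y h0 h1 h2 h3 h4 T hT
    simp only [Multiset.mem_add] at hT
    rcases hT with (((hT | hT) | hT) | hT) | hT
    · exact hS₁.not_adj h1 T hT
    · exact hS₂.not_adj h2 T hT
    · exact hS₃.not_adj h3 T hT
    · exact hS₄.not_adj h4 T hT
    · exact h0 T hT
  have hHab : ¬ H.Adj a b := h'.not_adj a ha b hb
  have hHcd : ¬ H.Adj c d := h.not_adj c hc d hd
  have restab := rest a b
    (fun T hT h' => hHab (hN.2 T hT a h.left_mem b h.right_mem h'))
    (by grind) (by grind) (by grind) (by grind)
  have restcd := rest c d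
    (fun T hT h => hHcd (hN.2 T hT c h'.left_mem d h'.right_mem h))
    (by grind) (by grind) (by grind) (by grind)
  refine ⟨merge (complete {a, b, c}) (complete {a, b, d}) a b ::ₘ (S₁ + S₂ + S₃ + S₄ + N),
    .single ⟨tS, _, _, _, a, b, rfl, (complete_isTriangle hab hac hbc).isPolygon,
      (complete_isTriangle hab had hbd).isPolygon, complete_adj.2 (by simp [hab]),
      complete_adj.2 (by simp [hab]),
      fun hG => hHab (hN.1 a h.left_mem b h.right_mem hG), restab, rfl⟩,
    .single ⟨tS', _, _, _, c, d, rfl, (complete_isTriangle hcd hac.symm had.symm).isPolygon,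
      (complete_isTriangle hcd hbc.symm hbd.symm).isPolygon, complete_adj.2 (by simp [hcd]),
      complete_adj.2 (by simp [hcd]),
      fun hG => hHcd (hN.1 c h'.left_mem d h'.right_mem hG), restcd, ?_⟩⟩
  rw [merge_complete_flip hab hac had hbc hbd hcd]

/-- Splittings that begin with two different cuts that do not cross. -/
theorem IsCut.cutsJoinable_of_not_crossing [Finite V] (hF : IsLinear F) (hH : IsNonseparable H)
    (h : IsCut H a b A B) (h' : IsCut H c d C D)
    (hself : CutsJoinable F G H N h.ne A B h.ne A B)
    (hself' : CutsJoinable F G H N h'.ne C D h'.ne C D)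
    (hne : ¬ ((a = c ∨ a = d) ∧ (b = c ∨ b = d))) (ha : a ∈ C ∪ {c, d}) (hb : b ∈ C ∪ {c, d})
    (hc : c ∈ A ∪ {a, b}) (hd : d ∈ A ∪ {a, b}) :
    CutsJoinable F G H N h.ne A B h'.ne C D := by
  have hab := h.ne
  have hcd := h'.ne
  have hn := h.right_notMem
  have hn' := h'.right_notMem
  have hAB := @h.notMem_right
  have hCD := @h'.notMem_right
  have hBC := h.nested_of_not_crossing h' hH hne ha hb hc hd
  have hDA := h'.nested_of_not_crossing h hH (by grind) hc hd ha hb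
  obtain ⟨S, T, S', T', hS, hT, hS', hT', he⟩ := exists_common_splitting_of_nested h h' hBC hDA
    ha hb hc hd
    (fun hs => by have := @hs a (by simp); have := @hs b (by simp); grind)
    (fun hs => by have := @hs c (by simp); have := @hs d (by simp); grind)
  refine CutsJoinable.of_common hF hself hself' hS hT hS' hT' ?_
  rw [he]
  exact (joinable_equivalence hF G).refl _

theorem IsCut.cutsJoinable [Finite V] (hF : IsLinear F) (hH : IsNonseparable H)
    (hN : IsLocal G H N) (hT : IsTreelike F (H ::ₘ N))
    (hself : ∀ {a b : V} {A B : Set V} (h : IsCut H a b A B),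
      CutsJoinable F G H N h.ne A B h.ne A B)
    (h : IsCut H a b A B) (h' : IsCut H c d C D) :
    CutsJoinable F G H N h.ne A B h'.ne C D := by
  by_cases hne : (a = c ∨ a = d) ∧ (b = c ∨ b = d)
  · have hab := h.ne
    have : a = c ∧ b = d ∨ a = d ∧ b = c := by grind
    rcases this with ⟨rfl, rfl⟩ | ⟨rfl, rfl⟩
    · exact h.cutsJoinable_of_same_nodes hF hself h'
    · exact (h.cutsJoinable_of_same_nodes hF hself h'.swap).swap_right
  -- the second cut separates `a` from `b`
  have cross : ∀ {C D : Set V} (h' : IsCut H c d C D), a ∈ C → b ∈ D →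
      CutsJoinable F G H N h.ne A B h'.ne C D := by
    intro C D h' ha hb
    rcases h'.crossing_symm h hH ha hb with ⟨hc, hd⟩ | ⟨hc, hd⟩
    · exact h.cutsJoinable_of_crossing hF hH hN hT h' (hself h) (hself h') ha hb hc hd
    · exact (h.symm.cutsJoinable_of_crossing hF hH hN hT h' (hself h.symm) (hself h')
        ha hb hc hd).flip_left
  have noncross : ∀ {C D : Set V} (h' : IsCut H c d C D), a ∈ C ∪ {c, d} → b ∈ C ∪ {c, d} →
      CutsJoinable F G H N h.ne A B h'.ne C D := by
    intro C D h' ha hb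
    have hc := (h.mem_iff c).1 h'.left_mem
    have hd := (h.mem_iff d).1 h'.right_mem
    have hn := h'.left_notMem
    have hn' := h'.right_notMem
    have hCD := @h'.notMem_right
    have hx : ∀ {A B : Set V}, IsCut H a b A B → c ∈ A → d ∈ B → False := fun h hc hd => by
      rcases h.crossing_symm h' hH hc hd with ⟨h1, h2⟩ | ⟨h1, h2⟩
      · have := @hCD b
        grind
      · have := @hCD a
        grind
    have hx1 := hx h
    have hx2 := hx h.symm
    by_cases hA : c ∈ A ∪ {a, b} ∧ d ∈ A ∪ {a, b}
    · exact h.cutsJoinable_of_not_crossing hF hH h' (hself h) (hself h') hne ha hb hA.1 hA.2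
    · exact (h.symm.cutsJoinable_of_not_crossing hF hH h' (hself h.symm) (hself h') hne ha hb
        (by grind) (by grind)).flip_left
  have ha := (h'.mem_iff a).1 h.left_mem
  have hb := (h'.mem_iff b).1 h.right_mem
  by_cases h1 : a ∈ C ∪ {c, d} ∧ b ∈ C ∪ {c, d}
  · exact noncross h' h1.1 h1.2
  by_cases h2 : a ∈ D ∪ {c, d} ∧ b ∈ D ∪ {c, d}
  · exact (noncross h'.symm h2.1 h2.2).flip_right
  have : a ∈ C ∧ b ∈ D ∨ a ∈ D ∧ b ∈ C := by grind
  rcases this with ⟨h3, h4⟩ | ⟨h3, h4⟩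
  · exact cross h' h3 h4
  · exact (cross h'.symm h3 h4).flip_right

end

/-- The induction on the number of nodes that compares any two splittings by their first cuts. -/
theorem IsNonseparable.splittingsJoinable [Finite V] {F : Set (Set V)} (hF : IsLinear F)
    (G : SimpleGraph V) {H : Piece V} (hH : IsNonseparable H) : SplittingsJoinable F G H := by
  induction hn : H.verts.ncard using Nat.strong_induction_on generalizing H with
  | _ n ih =>
    intro N hN hT S S' hS hS'
    have hself : ∀ {a b : V} {A B : Set V} (h : IsCut H a b A B),
        CutsJoinable F G H N h.ne A B h.ne A B := fun h =>
      h.cutsJoinable_self hF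
        (ih _ (hn ▸ h.ncard_side_lt) (h.isNonseparable_side hH) rfl)
        (ih _ (hn ▸ h.symm.ncard_side_lt) (h.symm.isNonseparable_side hH) rfl) hN hT
    cases hS with
    | done ht =>
      rw [hS'.eq_singleton ht]
      exact (joinable_equivalence hF G).refl _
    | split h hA hB =>
      cases hS' with
      | done ht => exact absurd h (ht _ _ _ _)
      | split h' hC hD => exact h.cutsJoinable hF hH hN hT hself h' _ _ _ _ hA hB hC hD

/-! ### Biconnected components -/

theorem mem_biconnectedComponents [Finite V] {G : SimpleGraph V} {B : Piece V} :
    B ∈ biconnectedComponents G ↔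
      Maximal (fun H : Piece V => (∀ x y, H.Adj x y → G.Adj x y) ∧ IsNonseparable H) B := by
  simp only [biconnectedComponents, Set.Finite.mem_toFinset, isNonseparable_iff]
  rfl

theorem adj_of_mem_biconnectedComponents [Finite V] {G : SimpleGraph V} {B : Piece V}
    (hB : B ∈ biconnectedComponents G) {x y : V} (hx : x ∈ B.verts) (hy : y ∈ B.verts)
    (hxy : G.Adj x y) : B.Adj x y := by
  rw [mem_biconnectedComponents] at hB
  have hT : (⊤ : SimpleGraph V).Adj x y := hxy.ne
  have hv : (B ⊔ (⊤ : SimpleGraph V).subgraphOfAdj hT).verts = B.verts := by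
    rw [SimpleGraph.Subgraph.verts_sup, SimpleGraph.subgraphOfAdj_verts,
      Set.union_eq_left]
    exact Set.pair_subset hx hy
  refine (hB.2 (y := B ⊔ (⊤ : SimpleGraph V).subgraphOfAdj hT) ⟨?_, ?_, ?_⟩ le_sup_left).2
    (Or.inr rfl)
  · rintro u v (h | h)
    · exact hB.1.1 u v h
    · rw [SimpleGraph.subgraphOfAdj_adj, Sym2.eq_iff] at h
      rcases h with ⟨rfl, rfl⟩ | ⟨rfl, rfl⟩
      exacts [hxy, hxy.symm]
  · rw [hv]
    exact hB.1.2.1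
  · rw [hv]
    intro v X Y hX hY hXY hs hs'
    obtain ⟨x, hx, y, hy, h⟩ := hB.1.2.2 v X Y hX hY hXY hs hs'
    exact ⟨x, hx, y, hy, Or.inl h⟩

/-- Two nonseparable graphs with two common nodes have a nonseparable union: a separation has to
keep each of them together, and one of the common nodes remains. -/
theorem IsNonseparable.sup [Finite V] {B B' : Piece V} (h : IsNonseparable B)
    (h' : IsNonseparable B') {a b : V} (hab : a ≠ b) (ha : a ∈ B.verts) (hb : b ∈ B.verts)
    (ha' : a ∈ B'.verts) (hb' : b ∈ B'.verts) : IsNonseparable (B ⊔ B') := by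
  refine ⟨h.1.trans (Set.ncard_le_ncard Set.subset_union_left), fun v X Y hX hY hXY hs hs' => ?_⟩
  rw [SimpleGraph.Subgraph.verts_sup] at hs hs'
  by_contra! hc
  have hd : ∀ z ∈ X, z ∉ Y := fun z hz => Set.disjoint_left.1 hXY hz
  have key : ∀ {K : Piece V}, IsNonseparable K → K ≤ B ⊔ B' →
      (∀ z ∈ K.verts, z ∉ X) ∨ ∀ z ∈ K.verts, z ∉ Y := by
    intro K hK hle
    by_contra! hn
    obtain ⟨⟨x, hxK, hx⟩, y, hyK, hy⟩ := hn
    obtain ⟨p, hp, q, hq, hpq⟩ := hK.2 v (K.verts ∩ X) (K.verts ∩ Y) ⟨x, hxK, hx⟩ ⟨y, hyK, hy⟩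
      (hXY.mono Set.inter_subset_right Set.inter_subset_right) (by grind)
      (fun z hz => by have := @hs' z (hle.1 hz); grind)
    exact hc p hp.2 q hq.2 (hle.2 hpq)
  have k1 := key h le_sup_left
  have k2 := key h' le_sup_right
  obtain ⟨x, hx⟩ := hX
  obtain ⟨y, hy⟩ := hY
  have h1 := hs (Or.inl hx)
  have h2 := hs (Or.inr hy)
  have h3 := @hs' a (Or.inl ha)
  have h4 := @hs' b (Or.inl hb)
  grind

theorem biconnectedComponents_eq_of_common [Finite V] {G : SimpleGraph V} {B B' : Piece V}
    (hB : B ∈ biconnectedComponents G) (hB' : B' ∈ biconnectedComponents G) {a b : V}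
    (hab : a ≠ b) (ha : a ∈ B.verts) (hb : b ∈ B.verts) (ha' : a ∈ B'.verts) (hb' : b ∈ B'.verts) :
    B = B' := by
  rw [mem_biconnectedComponents] at hB hB'
  have hU : (∀ x y, (B ⊔ B').Adj x y → G.Adj x y) ∧ IsNonseparable (B ⊔ B') :=
    ⟨fun x y h => h.elim (hB.1.1 x y) (hB'.1.1 x y), hB.1.2.sup hB'.1.2 hab ha hb ha' hb'⟩
  exact (hB.eq_of_le hU le_sup_left).trans (hB'.eq_of_le hU le_sup_right).symm

/-- The node sets of the biconnected components of `G`. -/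
def blockNodes [Finite V] (G : SimpleGraph V) : Set (Set V) :=
  {W | ∃ B ∈ biconnectedComponents G, W = B.verts}

theorem isLinear_blockNodes [Finite V] (G : SimpleGraph V) : IsLinear (blockNodes G) := by
  rintro _ ⟨B, hB, rfl⟩ _ ⟨B', hB', rfl⟩ a b hab ha hb ha' hb'
  rw [biconnectedComponents_eq_of_common hB hB' hab ha hb ha' hb']

theorem isTreelike_biconnectedComponents [Finite V] (G : SimpleGraph V) :
    IsTreelike (blockNodes G) (biconnectedComponents G).val := by
  refine ⟨fun B hB => ⟨_, ⟨B, hB, rfl⟩, subset_rfl⟩, ?_⟩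
  rintro N hN hne _ ⟨B, hB, rfl⟩ hsub
  -- a component inside `B` is `B` itself, so that `N` has no other member
  have hall : ∀ T ∈ N, T = B := by
    intro T hT
    have hTB : T ∈ biconnectedComponents G := Multiset.mem_of_le hN hT
    have h2 := (mem_biconnectedComponents.1 hTB).1.2.1
    obtain ⟨a, b, ha, hb, hab⟩ := (Set.one_lt_ncard_iff (Set.toFinite _)).1 h2
    exact biconnectedComponents_eq_of_common hTB hB hab ha hb (hsub T hT ha) (hsub T hT hb)
  have hN1 : N = {B} := by
    have hnd := Multiset.nodup_of_le hN (biconnectedComponents G).nodup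
    obtain ⟨T, hT⟩ := Multiset.exists_mem_of_ne_zero hne
    obtain ⟨N', rfl⟩ := Multiset.exists_cons_of_mem (hall T hT ▸ hT)
    rw [Multiset.nodup_cons] at hnd
    have : N' = 0 := Multiset.eq_zero_of_forall_notMem fun K hK =>
      hnd.1 (hall K (Multiset.mem_cons_of_mem hK) ▸ hK)
    rw [this]
    rfl
  subst hN1
  have : nodes {B} = B.verts := by
    ext x
    simp [nodes]
  rw [this]
  simp [excess]

theorem IsTreelike.sum_splitsInto [Finite V] {F : Set (Set V)} (hF : IsLinear F)
    {f : Piece V → Multiset (Piece V)} {s : Finset (Piece V)} {M : Multiset (Piece V)}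
    (hs : ∀ B ∈ s, SplitsInto B (f B)) (h : IsTreelike F (s.val + M)) :
    IsTreelike F (∑ B ∈ s, f B + M) := by
  classical
  induction s using Finset.induction_on generalizing M with
  | empty => simpa using h
  | insert B s hB ih =>
    rw [Finset.insert_val_of_notMem hB, Multiset.cons_add] at h
    have h1 := h.splitsInto hF (hs B (Finset.mem_insert_self _ _))
    rw [add_left_comm] at h1
    have h2 := ih (fun K hK => hs K (Finset.mem_insert_of_mem hK)) h1
    rwa [Finset.sum_insert hB, add_comm (f B), add_assoc]

/-- Exchanging the splittings of the biconnected components one by one. -/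
theorem joinable_sum [Finite V] {G : SimpleGraph V} {f f' : Piece V → Multiset (Piece V)}
    {s : Finset (Piece V)} {M : Multiset (Piece V)} (hsub : s ⊆ biconnectedComponents G)
    (hf : ∀ B ∈ s, SplitsInto B (f B)) (hf' : ∀ B ∈ s, SplitsInto B (f' B))
    (hM : ∀ T ∈ M, ∃ B ∈ biconnectedComponents G, B ∉ s ∧ T.verts ⊆ B.verts)
    (h : IsTreelike (blockNodes G) (s.val + M)) :
    Joinable (blockNodes G) G (∑ B ∈ s, f B + M) (∑ B ∈ s, f' B + M) := by
  classical
  have hF := isLinear_blockNodes G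
  induction s using Finset.induction_on generalizing M with
  | empty => exact (joinable_equivalence hF G).refl _
  | insert B s hB ih =>
    have hBs := Finset.mem_insert_self B s
    have hsub' := (Finset.subset_insert B s).trans hsub
    have hBG := hsub hBs
    have hfs := fun K hK => hf K (Finset.mem_insert_of_mem hK)
    have hfs' := fun K hK => hf' K (Finset.mem_insert_of_mem hK)
    rw [Finset.insert_val_of_notMem hB, Multiset.cons_add] at h
    have h1 := h.splitsInto hF (hf B hBs)
    rw [add_left_comm] at h1
    have j1 := ih (M := f B + M) hsub' hfs hfs' (fun T hT => by
      rcases Multiset.mem_add.1 hT with hT | hT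
      · exact ⟨B, hBG, hB, (hf B hBs).verts_subset T hT⟩
      · obtain ⟨K, hK, hKs, hTK⟩ := hM T hT
        exact ⟨K, hK, fun h => hKs (Finset.mem_insert_of_mem h), hTK⟩) h1
    rw [← Multiset.add_cons] at h
    have h2 := h.sum_splitsInto hF hfs'
    rw [Multiset.add_cons] at h2
    have hloc : IsLocal G B (∑ K ∈ s, f' K + M) := by
      refine ⟨fun x hx y hy hxy => adj_of_mem_biconnectedComponents hBG hx hy hxy,
        fun T hT x hx y hy hxy => ?_⟩
      have : ∃ K ∈ biconnectedComponents G, K ≠ B ∧ T.verts ⊆ K.verts := by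
        rcases Multiset.mem_add.1 hT with hT | hT
        · obtain ⟨K, hK, hTK⟩ := Multiset.mem_sum.1 hT
          exact ⟨K, hsub' hK, fun h => hB (h ▸ hK), (hfs' K hK).verts_subset T hTK⟩
        · obtain ⟨K, hK, hKs, hTK⟩ := hM T hT
          exact ⟨K, hK, fun h => hKs (h ▸ hBs), hTK⟩
      obtain ⟨K, hK, hKB, hTK⟩ := this
      exact absurd (biconnectedComponents_eq_of_common hK hBG hxy.ne (hTK (T.edge_vert hxy))
        (hTK (T.edge_vert hxy.symm)) hx hy) hKB
    have j2 := (mem_biconnectedComponents.1 hBG).1.2.splittingsJoinable hF G _ hloc h2 _ _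
      (hf B hBs) (hf' B hBs)
    rw [add_left_comm (f B), add_left_comm (f' B)] at j2
    rw [Finset.sum_insert hB, Finset.sum_insert hB, add_comm (f B), add_comm (f' B), add_assoc,
      add_assoc]
    exact (joinable_equivalence hF G).trans j1 j2

/-! ### Decompositions -/

theorem exists_isDecomposition [Finite V] (G : SimpleGraph V) : ∃ D, IsDecomposition G D := by
  choose f hf using exists_splitsInto (V := V)
  exact ⟨_, f, fun B _ => hf B, rfl⟩

namespace IsDecomposition

variable [Finite V] {G : SimpleGraph V} {D D' : Multiset (Piece V)}

theorem isTreelike (h : IsDecomposition G D) : IsTreelike (blockNodes G) D := by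
  obtain ⟨f, hf, rfl⟩ := h
  have := IsTreelike.sum_splitsInto (isLinear_blockNodes G) (M := 0) hf
    (by simpa using isTreelike_biconnectedComponents G)
  simpa using this

theorem joinable (h : IsDecomposition G D) (h' : IsDecomposition G D') :
    Joinable (blockNodes G) G D D' := by
  obtain ⟨f, hf, rfl⟩ := h
  obtain ⟨f', hf', rfl⟩ := h'
  have := joinable_sum (M := 0) subset_rfl hf hf' (by simp)
    (by simpa using isTreelike_biconnectedComponents G)
  simpa using this

theorem isTerminal (h : IsDecomposition G D) : ∀ T ∈ D, IsTerminal T := by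
  obtain ⟨f, hf, rfl⟩ := h
  intro T hT
  obtain ⟨B, hB, hTB⟩ := Multiset.mem_sum.1 hT
  exact (hf B hB).isTerminal T hTB

theorem classification (h : IsDecomposition G D) :
    ∀ T ∈ D, IsVertexConnected 3 T ∨ IsSingleLink T ∨ IsTriangle T := by
  intro T hT
  have ht := h.isTerminal T hT
  obtain ⟨f, hf, rfl⟩ := h
  obtain ⟨B, hB, hTB⟩ := Multiset.mem_sum.1 hT
  exact ((hf B hB).isNonseparable (mem_biconnectedComponents.1 hB).1.2 T hTB).classification ht

theorem sum_excess (h : IsDecomposition G D) :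
    (D.map excess).sum = ∑ B ∈ biconnectedComponents G, excess B := by
  obtain ⟨f, hf, rfl⟩ := h
  rw [← Multiset.coe_mapAddMonoidHom, map_sum, Multiset.sum_sum]
  exact Finset.sum_congr rfl fun B hB => (hf B hB).sum_excess

/-- Every triangle has excess one and every single link excess zero, so that the number of
components is determined by the total excess, the 3-vertex-connected components and the single
links. -/
theorem card_eq (h : IsDecomposition G D) : (Multiset.card D : ℤ) =
    ∑ B ∈ biconnectedComponents G, excess B - ((threeConnected D).map excess).sum +
      Multiset.card (threeConnected D) + Multiset.card (singleLinks D) := by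
  classical
  rw [← h.sum_excess]
  have hc := h.classification
  clear h
  induction D using Multiset.induction_on with
  | empty => simp [threeConnected, singleLinks]
  | cons T D ih =>
    have ih := ih fun K hK => hc K (Multiset.mem_cons_of_mem hK)
    have hT := hc T (Multiset.mem_cons_self T D)
    simp only [threeConnected, singleLinks] at ih ⊢
    by_cases h3 : IsVertexConnected 3 T
    · have h2 : ¬ IsSingleLink T := fun h => by
        have := h.1
        have := h3.1
        omega
      rw [Multiset.filter_cons_of_pos _ h3, Multiset.filter_cons_of_neg _ h2]
      simp only [Multiset.map_cons, Multiset.sum_cons, Multiset.card_cons]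
      push_cast
      omega
    · rw [Multiset.filter_cons_of_neg _ h3]
      by_cases h2 : IsSingleLink T
      · have := h2.1
        rw [Multiset.filter_cons_of_pos _ h2]
        simp only [Multiset.map_cons, Multiset.sum_cons, Multiset.card_cons, excess]
        push_cast
        omega
      · have := ((hT.resolve_left h3).resolve_left h2).1
        rw [Multiset.filter_cons_of_neg _ h2]
        simp only [Multiset.map_cons, Multiset.sum_cons, Multiset.card_cons, excess]
        push_cast
        omega

end IsDecomposition

/-! ### Invariants of merging -/

theorem filter_eq_of_reflTransGen [Finite V] {F : Set (Set V)} (hF : IsLinear F)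
    {G : SimpleGraph V} {D M : Multiset (Piece V)} (p : Piece V → Prop) [DecidablePred p]
    (hp : ∀ P, IsPolygon P → ¬ p P) (h : Relation.ReflTransGen (TreelikeStep F G) D M) :
    M.filter p = D.filter p := by
  induction h with
  | refl => rfl
  | tail _ h ih =>
    rw [← ih]
    obtain ⟨ht, P, Q, N, a, b, rfl, hP, hQ, haP, haQ, -, -, rfl⟩ := h
    rw [Multiset.filter_cons_of_neg _ (hp _ (ht.merge_isPolygon hF hP hQ haP haQ)),
      Multiset.filter_cons_of_neg _ (hp P hP), Multiset.filter_cons_of_neg _ (hp Q hQ)]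

/-- Merging regroups the members of a collection without 2-vertex cuts: each piece obtained is a
polygon or an unmerged member, and it comes with a complete splitting into the original members. -/
theorem exists_regrouping [Finite V] {F : Set (Set V)} (hF : IsLinear F) {G : SimpleGraph V}
    {D M : Multiset (Piece V)} (hD : ∀ T ∈ D, IsTerminal T)
    (h : Relation.ReflTransGen (TreelikeStep F G) D M) :
    (∀ Q ∈ M, IsPolygon Q ∨ IsTerminal Q) ∧ ∃ g : Piece V → Multiset (Piece V),
      (∀ Q ∈ M, SplitsInto Q (g Q)) ∧ (M.map g).sum = D := by
  classical
  induction h with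
  | refl =>
    exact ⟨fun Q hQ => Or.inr (hD Q hQ), fun Q => {Q}, fun Q hQ => .done (hD Q hQ),
      Multiset.sum_map_singleton D⟩
  | tail _ h ih =>
    obtain ⟨hM, g, hg, hsum⟩ := ih
    obtain ⟨ht, P, Q, N, a, b, rfl, hP, hQ, haP, haQ, -, -, rfl⟩ := h
    have hpoly := ht.merge_isPolygon hF hP hQ haP haQ
    have hI := ht.inter_eq hF haP.ne (P.edge_vert haP) (P.edge_vert haP.symm) (Q.edge_vert haQ)
      (Q.edge_vert haQ.symm)
    -- treelike collections do not contain the same polygon twice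
    have hnot : merge P Q a b ∉ N := by
      intro hmem
      obtain ⟨N', rfl⟩ := Multiset.exists_cons_of_mem hmem
      have ht' := ht.merge hF haP.ne (P.edge_vert haP) (P.edge_vert haP.symm) (Q.edge_vert haQ)
        (Q.edge_vert haQ.symm) (merge_verts P Q a b)
      have ha : a ∈ (merge P Q a b).verts := by simp [P.edge_vert haP]
      have hb : b ∈ (merge P Q a b).verts := by simp [P.edge_vert haP.symm]
      have h2 := ht'.inter_eq hF haP.ne ha hb ha hb
      rw [Set.inter_self] at h2
      have h3 := hpoly.three_le_ncard
      rw [h2, Set.ncard_pair haP.ne] at h3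
      omega
    refine ⟨fun K hK => ?_, Function.update g (merge P Q a b) (g P + g Q), fun K hK => ?_, ?_⟩
    · rcases Multiset.mem_cons.1 hK with rfl | hK
      · exact Or.inl hpoly
      · exact hM K (by simp [hK])
    · rcases Multiset.mem_cons.1 hK with rfl | hK
      · rw [Function.update_self]
        exact (hg P (by simp)).merge (hg Q (by simp)) hP.three_le_ncard hQ.three_le_ncard haP haQ hI
      · rw [Function.update_of_ne (ne_of_mem_of_not_mem hK hnot)]
        exact hg K (by simp [hK])
    · rw [← hsum, Multiset.map_cons, Multiset.sum_cons, Function.update_self,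
        Multiset.map_congr rfl fun K hK => Function.update_of_ne (ne_of_mem_of_not_mem hK hnot) _ _]
      simp [add_assoc]

theorem exists_splitting_of_polygons [Finite V] {F : Set (Set V)} (hF : IsLinear F)
    {G : SimpleGraph V} {D M : Multiset (Piece V)} (hD : ∀ T ∈ D, IsTerminal T)
    (h : Relation.ReflTransGen (TreelikeStep F G) D M) :
    ∃ f : Piece V → Multiset (Piece V), (∀ Q ∈ polygons M, SplitsInto Q (f Q)) ∧
      ((polygons M).map f).sum = triangles D := by
  classical
  obtain ⟨hM, g, hg, rfl⟩ := exists_regrouping hF hD h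
  have hmem : ∀ {Q}, Q ∈ polygons M → Q ∈ M ∧ IsPolygon Q := fun h => by
    simpa [polygons] using h
  refine ⟨g, fun Q hQ => hg Q (hmem hQ).1, ?_⟩
  have hsplit : M = polygons M + M.filter (fun Q => ¬ IsPolygon Q) := by
    rw [polygons]
    convert (Multiset.filter_add_not IsPolygon M).symm
  have h1 : ((polygons M).map g).sum.filter IsTriangle = ((polygons M).map g).sum := by
    refine Multiset.filter_eq_self.2 fun T hT => ?_
    obtain ⟨S, hS, hTS⟩ := Multiset.mem_join.1 hT
    obtain ⟨Q, hQ, rfl⟩ := Multiset.mem_map.1 hS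
    exact (hg Q (hmem hQ).1).isTriangle_of_isPolygon (hmem hQ).2 T hTS
  have h2 : ((M.filter (fun Q => ¬ IsPolygon Q)).map g).sum.filter IsTriangle = 0 := by
    refine Multiset.filter_eq_nil.2 fun T hT hTr => ?_
    obtain ⟨S, hS, hTS⟩ := Multiset.mem_join.1 hT
    obtain ⟨Q, hQ, rfl⟩ := Multiset.mem_map.1 hS
    obtain ⟨hQM, hQp⟩ := Multiset.mem_filter.1 hQ
    rw [(hg Q hQM).eq_singleton ((hM Q hQM).resolve_left hQp)] at hTS
    rw [Multiset.mem_singleton.1 hTS] at hTr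
    exact hQp hTr.isPolygon
  have h3 : (M.map g).sum.filter IsTriangle = ((polygons M).map g).sum := by
    conv_lhs => rw [hsplit, Multiset.map_add, Multiset.sum_add, Multiset.filter_add, h1, h2]
    simp
  rw [← h3, triangles]

/-! ### The four-cycle -/

/-- A spanning nonseparable `B` is the only biconnected component of the graph with its links. -/
theorem isDecomposition_spanningCoe {V : Type*} [Finite V] {B : Piece V} (hB : IsNonseparable B)
    (hs : B.verts = Set.univ) {S : Multiset (Piece V)} (hS : SplitsInto B S) :
    IsDecomposition B.spanningCoe S := by
  have htop : ∀ H : Piece V, (∀ x y, H.Adj x y → B.spanningCoe.Adj x y) → H ≤ B := fun H hH =>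
    ⟨by simp [hs], fun {x y} h => hH x y h⟩
  have hblocks : biconnectedComponents B.spanningCoe = {B} := by
    ext K
    rw [mem_biconnectedComponents, Finset.mem_singleton]
    constructor
    · exact fun hK => hK.eq_of_le ⟨fun x y h => h, hB⟩ (htop K hK.1.1)
    · rintro rfl
      exact ⟨⟨fun x y h => h, hB⟩, fun K hK _ => htop K hK.1⟩
  exact ⟨fun _ => S, by simpa [hblocks] using hS, by simp [hblocks]⟩

/-- The four-cycle is cut into two triangles along either of its diagonals. -/
theorem exists_isDecomposition_triangles_ne :
    ∃ (G : SimpleGraph (Fin 4)) (D D' : Multiset (Piece (Fin 4))),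
      G.Connected ∧ IsDecomposition G D ∧ IsDecomposition G D' ∧ triangles D ≠ triangles D' := by
  classical
  have tri : ∀ a b c : Fin 4, a ≠ b ∧ a ≠ c ∧ b ≠ c → IsTriangle (complete {a, b, c}) :=
    fun a b c h => complete_isTriangle h.1 h.2.1 h.2.2
  have t1 := tri 0 2 1 (by decide)
  have t2 := tri 0 2 3 (by decide)
  have t3 := tri 1 3 0 (by decide)
  have t4 := tri 1 3 2 (by decide)
  have i12 : (complete {0, 2, 1}).verts ∩ (complete {0, 2, 3}).verts = ({0, 2} : Set (Fin 4)) := by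
    ext x
    fin_cases x <;> simp
  have i34 : (complete {1, 3, 0}).verts ∩ (complete {1, 3, 2}).verts = ({1, 3} : Set (Fin 4)) := by
    ext x
    fin_cases x <;> simp
  have a1 : (complete ({0, 2, 1} : Set (Fin 4))).Adj 0 2 := complete_adj.2 (by simp)
  have a2 : (complete ({0, 2, 3} : Set (Fin 4))).Adj 0 2 := complete_adj.2 (by simp)
  have a3 : (complete ({1, 3, 0} : Set (Fin 4))).Adj 1 3 := complete_adj.2 (by simp)
  have a4 : (complete ({1, 3, 2} : Set (Fin 4))).Adj 1 3 := complete_adj.2 (by simp)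
  have hflip : merge (complete ({0, 2, 1} : Set (Fin 4))) (complete {0, 2, 3}) 0 2 =
      merge (complete {1, 3, 0}) (complete {1, 3, 2}) 1 3 :=
    merge_complete_flip (by decide) (by decide) (by decide) (by decide) (by decide) (by decide)
  have hpoly := merge_isPolygon t1.isPolygon t2.isPolygon a1 a2 i12
  have s1 := (SplitsInto.done t1.isTerminal).merge (.done t2.isTerminal) t1.1.ge t2.1.ge a1 a2 i12
  have s2 := (SplitsInto.done t3.isTerminal).merge (.done t4.isTerminal) t3.1.ge t4.1.ge a3 a4 i34
  rw [← hflip] at s2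
  have hspan : (merge (complete ({0, 2, 1} : Set (Fin 4))) (complete {0, 2, 3}) 0 2).verts =
      Set.univ := by
    ext x
    fin_cases x <;> simp
  refine ⟨(merge (complete {0, 2, 1}) (complete {0, 2, 3}) 0 2).spanningCoe, _, _, ?_,
    isDecomposition_spanningCoe hpoly.isNonseparable hspan s1,
    isDecomposition_spanningCoe hpoly.isNonseparable hspan s2, fun he => ?_⟩
  · exact (SimpleGraph.Subgraph.spanningCoeEquivCoeOfSpanning _
      (SimpleGraph.Subgraph.isSpanning_iff.2 hspan)).connected_iff.2 hpoly.1.coe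
  · have hmem : complete ({0, 2, 1} : Set (Fin 4)) ∈ triangles
        (({complete {0, 2, 1}} : Multiset (Piece (Fin 4))) + {complete {0, 2, 3}}) := by
      simp [triangles, t1]
    rw [he] at hmem
    have hmem' := Multiset.mem_of_mem_filter hmem
    simp only [Multiset.mem_add, Multiset.mem_singleton] at hmem'
    -- the node 2 or the node 0 distinguishes the triangles
    rcases hmem' with h | h
    · have : (2 : Fin 4) ∈ (complete ({1, 3, 0} : Set (Fin 4))).verts := h ▸ by simp
      simp at this
    · have : (0 : Fin 4) ∈ (complete ({1, 3, 2} : Set (Fin 4))).verts := h ▸ by simp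
      simp at this

end Piece

theorem mainTheorem4 :
    (∀ (V : Type*) [Finite V] (G : SimpleGraph V),
      (∃ D, Piece.IsDecomposition G D) ∧
      ∃ (C L P : Multiset (Piece V)) (N : ℕ),
        (∀ D, Piece.IsDecomposition G D →
          (∀ T ∈ D, Piece.IsVertexConnected 3 T ∨ Piece.IsSingleLink T ∨ Piece.IsTriangle T) ∧
          Piece.threeConnected D = C ∧
          Piece.singleLinks D = L ∧
          Multiset.card D = N ∧
          (∃ M, Piece.IsFullMerge G D M) ∧
          (∀ M, Piece.IsFullMerge G D M →
            Piece.polygons M = P ∧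
            ∃ f : Piece V → Multiset (Piece V),
              (∀ Q ∈ P, Piece.SplitsInto Q (f Q)) ∧
              (P.map f).sum = Piece.triangles D)) ∧
        (∀ Q ∈ P, ∀ S, Piece.SplitsInto Q S →
          (∀ T ∈ S, Piece.IsTriangle T) ∧ Multiset.card S + 2 = Q.verts.ncard)) ∧
    (∃ (G : SimpleGraph (Fin 4)) (D D' : Multiset (Piece (Fin 4))),
      G.Connected ∧ Piece.IsDecomposition G D ∧ Piece.IsDecomposition G D' ∧
        Piece.triangles D ≠ Piece.triangles D') := by
  classical
  refine ⟨fun V _ G => ⟨Piece.exists_isDecomposition G, ?_⟩,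
    Piece.exists_isDecomposition_triangles_ne⟩
  have hF := Piece.isLinear_blockNodes G
  obtain ⟨D₀, hD₀⟩ := Piece.exists_isDecomposition G
  obtain ⟨M₀, hM₀⟩ := Piece.exists_isFullMerge G D₀
  have hmerge : ∀ D, Piece.IsDecomposition G D → ∀ M, Piece.IsFullMerge G D M → M = M₀ :=
    fun D hD M hM => (hD.joinable hD₀).fullMerge_unique hF hD.isTreelike hD₀.isTreelike hM hM₀
  have hstep : ∀ D, Piece.IsDecomposition G D →
      Relation.ReflTransGen (Piece.TreelikeStep (Piece.blockNodes G) G) D M₀ := by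
    intro D hD
    obtain ⟨M, hM⟩ := Piece.exists_isFullMerge G D
    rw [← hmerge D hD M hM]
    exact (Piece.reflTransGen_treelikeStep hF hD.isTreelike hM.1).1
  have hthree : ∀ D, Piece.IsDecomposition G D →
      Piece.threeConnected M₀ = Piece.threeConnected D := fun D hD =>
    Piece.filter_eq_of_reflTransGen hF _ (fun P hP => hP.not_isVertexConnected_three) (hstep D hD)
  have hlinks : ∀ D, Piece.IsDecomposition G D →
      Piece.singleLinks M₀ = Piece.singleLinks D := fun D hD =>
    Piece.filter_eq_of_reflTransGen hF _ (fun P hP => hP.not_isSingleLink) (hstep D hD)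
  refine ⟨Piece.threeConnected M₀, Piece.singleLinks M₀, Piece.polygons M₀, Multiset.card D₀,
    fun D hD => ⟨hD.classification, (hthree D hD).symm, (hlinks D hD).symm, ?_,
      Piece.exists_isFullMerge G D, fun M hM => ?_⟩, fun Q hQ S hS => ?_⟩
  · have h1 := hD.card_eq
    have h2 := hD₀.card_eq
    rw [← hthree D hD, ← hlinks D hD] at h1
    rw [← hthree D₀ hD₀, ← hlinks D₀ hD₀] at h2
    omega
  · rw [hmerge D hD M hM]
    exact ⟨rfl, Piece.exists_splitting_of_polygons hF hD.isTerminal (hstep D hD)⟩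
  · have hQ' : Piece.IsPolygon Q := (Multiset.mem_filter.1 hQ).2
    exact ⟨hS.isTriangle_of_isPolygon hQ', hS.card_add_two hQ'⟩
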